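/- Let $k$ be a finite field, let $X$ be an irreducible affine $k$-smooth variety, let $\mathcal O$ be the semi-local ring of a non-empty finite set of closed points of $X$, and put $U=\operatorname{Spec}\mathcal O$; for a point $u$ write $k(u)$ for its residue field. Let $Z\subset\mathbb A^1_U$ be a closed subscheme finite over $U$. Let $Y'\to U$ be a finite étale morphism such that for every closed point $u\in U$ the fibre $Y'_u$ of $Y'$ over $u$ contains a $k(u)$-rational point. Then there are finite field extensions $k_1$ and $k_2$ of $k$ such that (i) the degrees $[k_1:k]$ and $[k_2:k]$ are coprime; (ii) for every closed point $u\in U$ the ring $k(u)\otimes_k k_r$ is a field for $r=1$ and $r=2$; (iii) both degrees $[k_1:k]$ and $[k_2:k]$ are strictly greater than each of the degrees $[k(z):k(u)]$, where $z$ runs over all closed points of $Z$ and $u\in U$ is the image of $z$; and there is a morphism $i$ such that (iv) $i: Y''=(Y'\otimes_k k_1)\sqcup(Y'\otimes_k k_2)\hookrightarrow\mathbb A^1_U$ is a closed embedding of $U$-schemes; (v) $Y\cap Z=\emptyset$, where $Y=i(Y'')$; (vi) $\operatorname{Pic}(\mathbb P^1_u-Y_u)=0$ for every closed point $u\in U$,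 where $Y_u\subset\mathbb A^1_u\subset\mathbb P^1_u$ is the fibre of $Y$ over $u$. -/

import Mathlib

open CategoryTheory CategoryTheory.Limits AlgebraicGeometry
open scoped TensorProduct

universe u

noncomputable section

namespace SemilocalLine

/-! ### The semi-local scheme of finitely many points on an affine scheme -/

/-- The functions on `X` that vanish at no point of the finite set `s`. -/
def nonvanishing (X : Scheme.{u}) (s : Finset X) : Submonoid Γ(X, ⊤) where
  carrier := {f | ∀ x ∈ s, x ∈ X.basicOpen f}
  one_mem' := fun x _ => by simp
  mul_mem' := fun {f g} hf hg x hx => by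
    rw [Scheme.basicOpen_mul]
    exact ⟨hf x hx, hg x hx⟩

/-- `U = Spec 𝒪`, where `𝒪` is the semi-local ring of the points of `s` on the affine scheme `X`,
that is, the localization of the ring of functions on `X` at the functions that vanish at no
point of `s`. -/
def semilocalSpec (X : Scheme.{u}) (s : Finset X) : Scheme.{u} :=
  Spec (CommRingCat.of (Localization (nonvanishing X s)))

/-- The canonical morphism `U ⟶ X`. -/
def semilocalSpecι (X : Scheme.{u}) [IsAffine X] (s : Finset X) : semilocalSpec X s ⟶ X :=
  Spec.map (CommRingCat.ofHom (algebraMap Γ(X, ⊤) (Localization (nonvanishing X s)))) ≫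
    X.isoSpec.inv

/-! ### Schemes over a field -/

/-- The spectrum of a field extension `l` of `k`, over `Spec k`. -/
def specExt (k l : Type u) [Field k] [Field l] [Algebra k l] :
    Spec (CommRingCat.of l) ⟶ Spec (CommRingCat.of k) :=
  Spec.map (CommRingCat.ofHom (algebraMap k l))

/-- `Y ⊗_k l`, the base change of the `k`-scheme `g : Y ⟶ Spec k` along `l / k`. -/
abbrev extendScalars {k : Type u} [Field k] {Y : Scheme.{u}} (g : Y ⟶ Spec (CommRingCat.of k))
    (l : Type u) [Field l] [Algebra k l] : Scheme.{u} :=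
  pullback g (specExt k l)

/-- For a `k`-scheme `g : U ⟶ Spec k` and a point `u` of `U`, the embedding `k ⟶ k(u)`. -/
def toResidueField {k : Type u} [Field k] {U : Scheme.{u}} (g : U ⟶ Spec (CommRingCat.of k))
    (u : U) : k →+* U.residueField u :=
  (Spec.preimage (U.fromSpecResidueField u ≫ g)).hom

/-- The ring `k(u) ⊗_k l` is a field. -/
def IsFieldResidueTensor {k : Type u} [Field k] {U : Scheme.{u}}
    (g : U ⟶ Spec (CommRingCat.of k)) (u : U) (l : Type u) [Field l] [Algebra k l] : Prop :=
  letI : Algebra k (U.residueField u) := (toResidueField g u).toAlgebra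
  IsField (U.residueField u ⊗[k] l)

/-- The morphism `f : Y ⟶ U` has a `k(u)`-rational point in its fibre over `u`. -/
def HasRationalPointOver {Y U : Scheme.{u}} (f : Y ⟶ U) (u : U) : Prop :=
  ∃ σ : Spec (U.residueField u) ⟶ f.fiber u, σ ≫ f.fiberToSpecResidueField u = 𝟙 _

/-! ### The affine line and the projective line -/

/-- The affine line over `S`. -/
abbrev AffineLine (S : Scheme.{u}) : Scheme.{u} := AffineSpace PUnit.{u + 1} S

/-- The projection of the affine line to its base. -/
abbrev AffineLine.proj (S : Scheme.{u}) : AffineLine S ⟶ S := AffineLine S ↘ S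

/-- The closed embedding over `u` of the affine line `𝔸¹_u` over `k(u)` into `𝔸¹_U`. -/
abbrev AffineLine.fromFibre (U : Scheme.{u}) (u : U) :
    AffineLine (Spec (U.residueField u)) ⟶ AffineLine U :=
  AffineSpace.map PUnit.{u + 1} (U.fromSpecResidueField u)

attribute [local instance] MvPolynomial.gradedAlgebra

/-- The projective line over `Spec K`: `Proj` of `K[x₀, x₁]` with the standard grading. -/
abbrev ProjectiveLine (K : CommRingCat.{u}) : Scheme.{u} :=
  Proj (MvPolynomial.homogeneousSubmodule (Fin 2) K)

/-- The homomorphism `K[x₀, x₁] ⟶ K[t]`, `x₀ ↦ 1`, `x₁ ↦ t`. -/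
def dehomogenize (K : Type u) [CommRing K] :
    MvPolynomial (Fin 2) K →+* MvPolynomial PUnit.{u + 1} K :=
  (MvPolynomial.aeval ![1, MvPolynomial.X PUnit.unit] :
    MvPolynomial (Fin 2) K →ₐ[K] MvPolynomial PUnit.{u + 1} K).toRingHom

theorem isUnit_dehomogenize_X (K : Type u) [CommRing K] :
    IsUnit (dehomogenize K (MvPolynomial.X 0)) := by
  simp [dehomogenize]

/-- The isomorphism `K[x₀, x₁]_(x₀) ⟶ K[t]`, `f / x₀ ^ n ↦ f (1, t)`, from the degree zero part
of the localization. -/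
def awayToPolynomial (K : Type u) [CommRing K] :
    HomogeneousLocalization.Away (MvPolynomial.homogeneousSubmodule (Fin 2) K)
      (MvPolynomial.X 0) →+* MvPolynomial PUnit.{u + 1} K :=
  (IsLocalization.Away.lift (S := Localization.Away (MvPolynomial.X (R := K) (0 : Fin 2)))
    (MvPolynomial.X (0 : Fin 2)) (isUnit_dehomogenize_X K)).comp
    (algebraMap _ (Localization.Away (MvPolynomial.X (R := K) (0 : Fin 2))))

/-- The standard open embedding `𝔸¹_K ⟶ ℙ¹_K`, `t ↦ [1 : t]`, with image `x₀ ≠ 0`. -/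
def affineToProjectiveLine (K : CommRingCat.{u}) : AffineLine (Spec K) ⟶ ProjectiveLine K :=
  (AffineSpace.SpecIso PUnit.{u + 1} K).hom ≫
    Spec.map (CommRingCat.ofHom (awayToPolynomial K)) ≫
      Proj.awayι (MvPolynomial.homogeneousSubmodule (Fin 2) K) (MvPolynomial.X 0)
        (MvPolynomial.isHomogeneous_X K 0) Nat.one_pos

/-- For a morphism `i : Y ⟶ 𝔸¹_U` and a point `u` of `U`, the set of points of `ℙ¹_u` that lie in
the fibre over `u` of the image of `i`. -/
def fibreInProjectiveLine {Y U : Scheme.{u}} (i : Y ⟶ AffineLine U) (u : U) :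
    Set (ProjectiveLine (U.residueField u)) :=
  affineToProjectiveLine (U.residueField u) '' (AffineLine.fromFibre U u ⁻¹' Set.range i)

/-! ### The Picard group -/

/-- The structure sheaf, as a sheaf of modules over itself. -/
abbrev structureSheaf (X : Scheme.{u}) : X.Modules := SheafOfModules.unit.{u} X.ringCatSheaf

/-- Invertible sheaves: sheaves of modules that are locally isomorphic to the structure sheaf. -/
def IsInvertibleSheaf {X : Scheme.{u}} (L : X.Modules) : Prop :=
  ∀ x : X, ∃ W : X.Opens, x ∈ W ∧ Nonempty (L.restrict W.ι ≅ structureSheaf W.toScheme)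

theorem isInvertibleSheaf_structureSheaf (X : Scheme.{u}) :
    IsInvertibleSheaf (structureSheaf X) :=
  fun _ => ⟨⊤, trivial, ⟨Scheme.Modules.restrictUnitIso _⟩⟩

/-- Isomorphism of invertible sheaves. -/
def picSetoid (X : Scheme.{u}) : Setoid {L : X.Modules // IsInvertibleSheaf L} where
  r L M := Nonempty (L.1 ≅ M.1)
  iseqv := ⟨fun _ => ⟨Iso.refl _⟩, fun ⟨e⟩ => ⟨e.symm⟩, fun ⟨e⟩ ⟨f⟩ => ⟨e ≪≫ f⟩⟩

/-- The set of isomorphism classes of invertible sheaves on `X`, which underlies the Picard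
group. -/
def Pic (X : Scheme.{u}) : Type (u + 1) := Quotient (picSetoid X)

/-- The neutral element of the Picard group is the class of the structure sheaf. -/
instance (X : Scheme.{u}) : Zero (Pic X) :=
  ⟨Quotient.mk (picSetoid X) ⟨structureSheaf X, isInvertibleSheaf_structureSheaf X⟩⟩

end SemilocalLine

end

open SemilocalLine

noncomputable section

namespace SemilocalLine

/-! Write `Y' = Spec B` over `U = Spec O` and `D = (B ⊗ k₁) × (B ⊗ k₂)`. A closed embedding of `Spec
D` into the affine line over `O` is a generator `d` of `D` as an `O`-algebra, so everything rests on
choosing the degrees of `k₁` and `k₂` well.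

The degrees are primes `p < q ≤ 2p`, with `p` large. They exceed all `[O/m : k]`, so each `(O/m) ⊗
k_r` is a field. They also exceed a bound for the residue degrees of `Z`.

Existence of `d`: by Nakayama and the Chinese remainder theorem it suffices to generate `κ ⊗ D` over
each finite residue field `κ` of `O` (`exists_adjoin_singleton_eq_top_of_maximalSpectrum`). This
algebra is a finite product of finite fields, each containing some `κ ⊗ k_r` and so of degree at
least `p`. Its dimension is at most `3Np`, where `N` bounds the rank of `B`, so there are at most
`3N` factors whatever `p` is. For large `p` there are more monic irreducible polynomials in each
relevant degree than factors. The factors then have generators with distinct minimal polynomials,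
which together generate the product (`exists_generator_residue_tensor`).

Disjointness from `Z`: a closed point `z` of `Z` on the image of `Spec D` would give a map from some
`k_r` to `k(z)`, hence an embedding of `k(u) ⊗ k_r` in `k(z)`, against the choice of degrees.

Picard group: the fibre over `u` is the zero locus of a monic polynomial `f`. The rational point of
`Y'_u` yields divisors of `f` of the coprime degrees `p` and `q`. With `F` the homogenization of
`f`, the complement of the fibre is `Spec` of the degree zero part of `K[x₀, x₁]_F`. Coprimality
supplies a homogeneous unit of degree one, which makes this ring a retract of the factorial ring
`K[x₀, x₁]_F`, so its Picard group vanishes (`exists_retraction_away`). Quasi-coherence carries this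
from invertible modules to invertible sheaves. -/

/-! ### Invertible sheaves: restriction, transport and quasi-coherence. -/

theorem isInvertibleSheaf_restrict {X Y : Scheme.{u}} (f : X ⟶ Y) [IsOpenImmersion f]
    {L : Y.Modules} (hL : IsInvertibleSheaf L) : IsInvertibleSheaf (L.restrict f) := by
  intro x
  obtain ⟨W, hxW, ⟨e⟩⟩ := hL (f x)
  refine ⟨f ⁻¹ᵁ W, hxW, ⟨?_⟩⟩
  have h : (f ⁻¹ᵁ W).ι ≫ f = (f ∣_ W) ≫ W.ι := (morphismRestrict_ι f W).symm
  exact ((Scheme.Modules.restrictFunctorComp (f ⁻¹ᵁ W).ι f).app L).symm ≪≫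
    (Scheme.Modules.restrictFunctorCongr h).app L ≪≫
    (Scheme.Modules.restrictFunctorComp (f ∣_ W) W.ι).app L ≪≫
    (Scheme.Modules.restrictFunctor (f ∣_ W)).mapIso e ≪≫
    Scheme.Modules.restrictUnitIso (f ∣_ W)

theorem isInvertibleSheaf_trivial_of_iso {X Y : Scheme.{u}} (e : X ≅ Y)
    (hY : ∀ L : Y.Modules, IsInvertibleSheaf L → Nonempty (L ≅ structureSheaf Y))
    (L : X.Modules) (hL : IsInvertibleSheaf L) : Nonempty (L ≅ structureSheaf X) := by
  obtain ⟨i⟩ := hY _ (isInvertibleSheaf_restrict e.inv hL)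
  refine ⟨(Scheme.Modules.restrictFunctorId.app L).symm ≪≫
    (Scheme.Modules.restrictFunctorCongr e.hom_inv_id.symm).app L ≪≫
    (Scheme.Modules.restrictFunctorComp e.hom e.inv).app L ≪≫
    (Scheme.Modules.restrictFunctor e.hom).mapIso i ≪≫ Scheme.Modules.restrictUnitIso e.hom⟩

theorem pic_eq_zero_of_forall_iso {X : Scheme.{u}}
    (h : ∀ L : X.Modules, IsInvertibleSheaf L → Nonempty (L ≅ structureSheaf X)) (c : Pic X) :
    c = 0 := by
  induction c using Quotient.inductionOn with
  | h L => exact Quotient.sound (h L.1 L.2)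

/-- The sheaf of rings, as a module over itself, has a presentation with one generator and no
relations. -/
def unitPresentation {C : Type*} [Category* C] {J : GrothendieckTopology C}
    (R : Sheaf J RingCat.{u}) [HasSheafify J AddCommGrpCat.{u}]
    [J.WEqualsLocallyBijective AddCommGrpCat.{u}] :
    (SheafOfModules.unit R).Presentation :=
  haveI : IsIso (SheafOfModules.free.generatingSections (R := R) PUnit.{u + 1}).π :=
    (SheafOfModules.free.generatingSections_π (R := R) PUnit.{u + 1}).symm ▸
      (inferInstance : IsIso (𝟙 (SheafOfModules.free (R := R) PUnit.{u + 1})))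
  let σ : (SheafOfModules.free (R := R) PUnit.{u + 1}).Presentation :=
    { generators := SheafOfModules.free.generatingSections PUnit.{u + 1}
      relations :=
        { I := ULift Empty
          s := fun j => j.down.elim
          -- The generators map isomorphically, so the kernel is zero and the empty family of
          -- relations generates it.
          epi := IsZero.epi (IsZero.of_iso (isZero_zero _) (Limits.kernel.ofMono _)) _ } }
  let e : SheafOfModules.free (R := R) PUnit.{u + 1} ≅ SheafOfModules.unit R :=
    coproductUniqueIso fun _ : PUnit.{u + 1} => SheafOfModules.unit R
  SheafOfModules.Presentation.ofIsIso.{u} e.hom σ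

/-- The one-generator presentation of the structure sheaf transports along each local
trivialization. -/
theorem IsInvertibleSheaf.isQuasicoherent {X : Scheme.{u}} {L : X.Modules}
    (hL : IsInvertibleSheaf L) : L.IsQuasicoherent := by
  choose W hW e using hL
  refine SheafOfModules.QuasicoherentData.isQuasicoherent (R := X.ringCatSheaf) (M := L)
    { I := X
      X := W
      coversTop := ?_
      presentation := fun x => ?_ }
  · rw [Opens.coversTop_iff]
    exact top_unique fun x _ => by simpa using ⟨x, hW x⟩
  · let F := (Scheme.Modules.overEquiv (W x)).inverse
    let i : L.over (W x) ≅ SheafOfModules.unit (X.ringCatSheaf.over (W x)) :=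
      (Scheme.Modules.overEquiv (W x)).unitIso.app _ ≪≫
        F.mapIso ((Scheme.Modules.overFunctorEquiv (W x)).app L ≪≫ (e x).some) ≪≫
        TopologicalSpace.Opens.sheafOfModulesEquivOverInverseUnit _ _
    exact SheafOfModules.Presentation.ofIsIso.{u} i.inv (unitPresentation _)

/-! ### Locally free modules of rank one are invertible. -/

section InvertibleModule

variable {R M : Type*} [CommRing R] [AddCommGroup M] [Module R M]

/-- After multiplication by `r i`, every vector is a multiple of `m i` and every functional a
multiple of `φ i`. A tensor killed by the contraction is therefore killed by every `r i * r i`, and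
these still generate the unit ideal. The image of the contraction contains every `r i`. -/
theorem invertible_of_dual_family {ι : Type*} (r : ι → R) (φ : ι → Module.Dual R M) (m : ι → M)
    (hr : Ideal.span (Set.range r) = ⊤) (hφ : ∀ i, φ i (m i) = r i)
    (hm : ∀ i x, φ i x • m i = r i • x) : Module.Invertible R M := by
  have hdual : ∀ i (ψ : Module.Dual R M), r i • ψ = ψ (m i) • φ i := fun i ψ => by
    ext x
    have := congr(ψ $(hm i x))
    simp only [map_smul, smul_eq_mul] at this
    simp [← this, mul_comm]
  have hker : ∀ i (t : Module.Dual R M ⊗[R] M),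
      (r i * r i) • t = r i • (contractLeft R M t • (φ i ⊗ₜ[R] m i)) := fun i t => by
    induction t with
    | zero => simp
    | add x y hx hy => simp only [smul_add, map_add, add_smul, hx, hy]
    | tmul ψ x =>
      have h : (r i * r i) • (ψ ⊗ₜ[R] x) = (r i • ψ) ⊗ₜ[R] (r i • x) := by
        rw [TensorProduct.smul_tmul_smul]
      rw [h, hdual, ← hm, TensorProduct.smul_tmul_smul, smul_smul, contractLeft_apply]
      congr 1
      have := congr(ψ $(hm i x))
      simp only [map_smul, smul_eq_mul] at this
      rw [← this, mul_comm]
  have hspan : Ideal.span (Set.range fun i => r i * r i) = ⊤ := by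
    have := Ideal.span_pow_eq_top _ hr 2
    rw [← this, ← Set.range_comp]
    simp [Function.comp_def, pow_two]
  refine ⟨⟨(injective_iff_map_eq_zero _).2 fun t ht => ?_, ?_⟩⟩
  · have : ∀ a ∈ Ideal.span (Set.range fun i => r i * r i), a • t = 0 := by
      intro a ha
      induction ha using Submodule.span_induction with
      | mem a ha =>
        obtain ⟨i, rfl⟩ := ha
        simp [hker, ht]
      | zero => simp
      | add a b _ _ ha hb => simp [add_smul, ha, hb]
      | smul a b _ hb => simp [mul_smul, hb]
    simpa using this 1 (hspan ▸ trivial)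
  · rw [← LinearMap.range_eq_top, ← hr]
    refine le_antisymm (hr ▸ le_top) (Ideal.span_le.2 ?_)
    rintro _ ⟨i, rfl⟩
    exact ⟨φ i ⊗ₜ m i, by simp [hφ]⟩

/-- Clearing denominators in a local isomorphism and in a local generator produces the family
required by `invertible_of_dual_family`, up to powers of `f`. Finite presentation, itself a local
property, allows the denominators to be cleared. -/
theorem invertible_of_locally_iso
    (h : ∀ p : PrimeSpectrum R, ∃ f ∉ p.asIdeal, ∃ g : M →ₗ[R] Localization.Away f,
      IsLocalizedModule (.powers f) g) : Module.Invertible R M := by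
  choose f hf g hg using h
  have hspan : ∀ a : PrimeSpectrum R → ℕ, Ideal.span (Set.range fun p => f p ^ a p) = ⊤ := by
    intro a
    by_contra hne
    obtain ⟨m, hm, hle⟩ := Ideal.exists_le_maximal _ hne
    exact hf ⟨m, hm.isPrime⟩ (hm.isPrime.mem_of_pow_mem _ (hle (Ideal.subset_span ⟨_, rfl⟩)))
  have : Module.FinitePresentation R M := by
    have hp : ∀ a : Set.range f, ∃ p, f p = a := fun a => a.2
    choose q hq using hp
    have hl : ∀ a : Set.range f, ∃ g' : M →ₗ[R] Localization.Away a.1,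
        IsLocalizedModule (.powers a.1) g' := fun a => by
      rw [← hq a]; exact ⟨g _, hg _⟩
    choose g' hg' using hl
    exact Module.FinitePresentation.of_localizationSpan' (Set.range f)
      (by simpa using hspan fun _ => 1)
      (Rₚ := fun a => Localization.Away a.1) (Mₚ := fun a => Localization.Away a.1) g'
      fun a => inferInstance
  have key : ∀ p, ∃ (a : ℕ) (φ : Module.Dual R M) (m : M), φ m = f p ^ a ∧
      ∀ x, φ x • m = f p ^ a • x := by
    intro p
    obtain ⟨φ, ⟨_, b, rfl⟩, hφ⟩ := Module.FinitePresentation.exists_lift_of_isLocalizedModule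
      (.powers (f p)) (Algebra.linearMap R (Localization.Away (f p))) (g p)
    obtain ⟨⟨m, ⟨_, c, rfl⟩⟩, hm⟩ := IsLocalizedModule.surj (.powers (f p)) (g p) 1
    simp only [Submonoid.smul_def] at hm hφ
    have hφ' : ∀ x, algebraMap R (Localization.Away (f p)) (φ x) = f p ^ b • g p x := fun x =>
      congr($hφ x)
    obtain ⟨⟨_, d, rfl⟩, hd⟩ := Module.Finite.exists_smul_of_comp_eq_of_isLocalizedModule
      (.powers (f p)) (f := g p) (φ.smulRight m) (f p ^ (b + c) • LinearMap.id) (by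
        ext x
        simp only [LinearMap.comp_apply, LinearMap.smulRight_apply, map_smul, LinearMap.smul_apply,
          LinearMap.id_apply]
        rw [← hm, ← algebraMap_smul (Localization.Away (f p)) (φ x), hφ']
        simp only [Algebra.smul_def, map_pow, Algebra.algebraMap_self, RingHom.id_apply]
        ring)
    obtain ⟨⟨_, e, rfl⟩, he⟩ := IsLocalization.exists_of_eq (M := .powers (f p))
      (S := Localization.Away (f p)) (x := φ m) (y := f p ^ (b + c)) (by
        rw [hφ', ← hm]
        simp only [Algebra.smul_def, map_pow]
        ring)
    simp only at he
    -- Locally `φ` is `f ^ b` times the isomorphism and `m` maps to `f ^ c`. The exponents `d` and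
    -- `e` make the two resulting identities hold before localization.
    refine ⟨d + e + (b + c), f p ^ (d + e) • φ, m, ?_, fun x => ?_⟩
    · rw [LinearMap.smul_apply, smul_eq_mul, pow_add, mul_assoc, he]
      ring
    · have := congr(f p ^ e • $hd x)
      simp only [Submonoid.smul_def, LinearMap.smul_apply, LinearMap.smulRight_apply, smul_smul,
        LinearMap.id_apply] at this ⊢
      rw [smul_eq_mul, show f p ^ (d + e) * φ x = f p ^ e * (f p ^ d * φ x) by ring, this]
      congr 1
      ring
  choose a φ m h₁ h₂ using key
  exact invertible_of_dual_family (fun p => f p ^ a p) φ m (hspan a) h₁ h₂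

end InvertibleModule

/-! ### Invertible sheaves on an affine scheme. -/

section Spec

variable {R : CommRingCat.{u}}

/-- The `R`-module of global sections of the structure sheaf of `Spec R` is free of rank one. -/
def sectionsStructureSheaf : Γ(structureSheaf (Spec R), ⊤) ≃ₗ[R] R :=
  (tilde.isoTop (ModuleCat.of R R)).toLinearEquiv.symm

/-- Quasi-coherence makes restriction to the basic open set of `f` a localization of global
sections, and the trivialization identifies its target with `S`. -/
theorem exists_isLocalizedModule_of_restrict_iso {S : CommRingCat.{u}} [Algebra R S] (φ : R ⟶ S)
    (hφ : φ.hom = algebraMap R S) [IsOpenImmersion (Spec.map φ)] (f : R)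
    (hr : (Spec.map φ).opensRange = PrimeSpectrum.basicOpen f) (L : (Spec R).Modules)
    (hL : IsIso L.fromTildeΓ) (i : L.restrict (Spec.map φ) ≅ structureSheaf (Spec S)) :
    ∃ g : Γ(L, ⊤) →ₗ[R] S, IsLocalizedModule (.powers f) g := by
  have hloc := (isIso_fromTildeΓ_iff_isLocalizing L).1 hL
  let i' : Γ(L.restrict (Spec.map φ), ⊤) ≃ₗ[S] S :=
    (moduleSpecΓFunctor.mapIso i).toLinearEquiv.trans sectionsStructureSheaf
  let j : Γ(L.restrict (Spec.map φ), ⊤) ≃+ Γ(L, Spec.map φ ''ᵁ ⊤) :=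
    (L.restrictAppIso (Spec.map φ) ⊤).addCommGroupIsoToAddEquiv
  let j' : S ≃ₗ[R] Γ(L, Spec.map φ ''ᵁ ⊤) :=
    { i'.symm.toAddEquiv.trans j with
      map_smul' := fun r x => by
        have h₁ : r • x = φ r • x := by rw [Algebra.smul_def, ← hφ]; rfl
        change j (i'.symm (r • x)) = r • j (i'.symm x)
        rw [h₁, map_smul i'.symm (φ r) x]
        exact Scheme.Modules.restrictAppIso_smul_Spec φ r (i'.symm x) }
  have hl : ∀ V : (Spec R).Opens, V = PrimeSpectrum.basicOpen f →
      IsLocalizedModule (.powers f) ((modulesSpecToSheaf.obj L).obj.map V.leTop.op).hom := by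
    rintro _ rfl; exact hloc f
  let g : Γ(L, ⊤) →ₗ[R] Γ(L, Spec.map φ ''ᵁ ⊤) :=
    ((modulesSpecToSheaf.obj L).obj.map (Spec.map φ ''ᵁ ⊤).leTop.op).hom
  have : IsLocalizedModule (.powers f) g :=
    hl (Spec.map φ ''ᵁ ⊤) ((Scheme.Hom.image_top_eq_opensRange _).trans hr)
  exact ⟨j'.symm.toLinearMap ∘ₗ g, IsLocalizedModule.of_linearEquiv _ g j'.symm⟩

theorem IsInvertibleSheaf.invertible_sections {L : (Spec R).Modules} (hL : IsInvertibleSheaf L) :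
    Module.Invertible R Γ(L, ⊤) := by
  have := hL.isQuasicoherent
  refine invertible_of_locally_iso fun p => ?_
  obtain ⟨W, hpW, ⟨e⟩⟩ := hL p
  obtain ⟨_, ⟨_, ⟨f, rfl⟩, rfl⟩, hpf, hfW : PrimeSpectrum.basicOpen f ≤ W⟩ :=
    PrimeSpectrum.isBasis_basic_opens.exists_subset_of_mem_open hpW W.2
  let φ : R ⟶ CommRingCat.of (Localization.Away f) := CommRingCat.ofHom (algebraMap _ _)
  have hr : (Spec.map φ).opensRange = PrimeSpectrum.basicOpen f :=
    TopologicalSpace.Opens.ext (PrimeSpectrum.localization_away_comap_range _ f)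
  let t : Spec (.of (Localization.Away f)) ⟶ W.toScheme :=
    IsOpenImmersion.lift W.ι (Spec.map φ) (by
      rw [← Scheme.Hom.coe_opensRange, hr, Scheme.Opens.range_ι]; exact hfW)
  have ht : Spec.map φ = t ≫ W.ι := (IsOpenImmersion.lift_fac _ _ _).symm
  have : IsOpenImmersion (t ≫ W.ι) := ht ▸ inferInstance
  have : IsOpenImmersion t := .of_comp _ W.ι
  exact ⟨f, hpf, exists_isLocalizedModule_of_restrict_iso φ rfl f hr L inferInstance
    ((Scheme.Modules.restrictFunctorCongr ht).app L ≪≫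
      (Scheme.Modules.restrictFunctorComp t W.ι).app L ≪≫
      (Scheme.Modules.restrictFunctor t).mapIso e ≪≫ Scheme.Modules.restrictUnitIso t)⟩

theorem IsInvertibleSheaf.nonempty_iso [Subsingleton (CommRing.Pic R)] {L : (Spec R).Modules}
    (hL : IsInvertibleSheaf L) : Nonempty (L ≅ structureSheaf (Spec R)) := by
  have := hL.isQuasicoherent
  have := hL.invertible_sections
  obtain ⟨e⟩ := Module.Invertible.free_iff_linearEquiv.1 (inferInstance : Module.Free R Γ(L, ⊤))
  exact ⟨(asIso L.fromTildeΓ).symm ≪≫ (tilde.functor R).mapIso e.toModuleIso ≪≫ tildeSelf⟩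

theorem pic_eq_zero_of_iso_Spec {X : Scheme.{u}} [Subsingleton (CommRing.Pic R)]
    (e : X ≅ Spec R) (c : Pic X) : c = 0 :=
  pic_eq_zero_of_forall_iso (isInvertibleSheaf_trivial_of_iso e fun _ => (·.nonempty_iso)) c

end Spec

/-! ### The complement of a divisor in the projective line. -/

section ProjectiveLine

attribute [local instance] MvPolynomial.gradedAlgebra

variable {K : Type u} [CommRing K]

theorem X_mem_homogeneousSubmodule (K : Type u) [CommRing K] (i : Fin 2) :
    MvPolynomial.X i ∈ MvPolynomial.homogeneousSubmodule (Fin 2) K 1 :=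
  MvPolynomial.isHomogeneous_X K i

/-- The homogenization `x₀ ^ n * p (x₁ / x₀)` of a polynomial `p` of degree `n`. -/
def homogenization (p : Polynomial K) : MvPolynomial (Fin 2) K :=
  -- `Polynomial.homogenize` adds the variable `X 1`, whereas the chart here inverts `X 0`; hence
  -- the swap.
  MvPolynomial.rename (Equiv.swap 0 1) (p.homogenize p.natDegree)

theorem isHomogeneous_homogenization (p : Polynomial K) :
    (homogenization p).IsHomogeneous p.natDegree :=
  p.isHomogeneous_homogenize.rename_isHomogeneous

theorem homogenization_mul [IsDomain K] {p q : Polynomial K} (hp : p ≠ 0) (hq : q ≠ 0) :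
    homogenization (p * q) = homogenization p * homogenization q := by
  rw [homogenization, Polynomial.natDegree_mul hp hq, Polynomial.homogenize_mul _ _ le_rfl le_rfl,
    map_mul, homogenization, homogenization]

theorem aeval_homogenization {A : Type*} [CommRing A] [Algebra K A] (p : Polynomial K) (y : A) :
    MvPolynomial.aeval ![1, y] (homogenization p) = Polynomial.aeval y p := by
  rw [homogenization, MvPolynomial.aeval_rename, Polynomial.aeval_homogenize_of_eq_one le_rfl]
  · simp
  · simp

theorem dehomogenize_homogenization (p : Polynomial K) :
    dehomogenize K (homogenization p) = (MvPolynomial.uniqueAlgEquiv K PUnit.{u + 1}).symm p := by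
  refine (aeval_homogenization p _).trans ?_
  simp [MvPolynomial.uniqueAlgEquiv_symm_apply, Polynomial.aeval_def, MvPolynomial.algebraMap_eq]

theorem homogenization_eq_of_isHomogeneous {n : ℕ} {q : MvPolynomial (Fin 2) K}
    (hq : q.IsHomogeneous n) {p : Polynomial K}
    (hp : dehomogenize K q = (MvPolynomial.uniqueAlgEquiv K PUnit.{u + 1}).symm p) :
    MvPolynomial.rename (Equiv.swap 0 1) (p.homogenize n) = q := by
  have h : MvPolynomial.aeval ![Polynomial.X, 1] (MvPolynomial.rename (Equiv.swap 0 1) q) = p := by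
    rw [AlgEquiv.eq_symm_apply] at hp
    rw [← hp, MvPolynomial.aeval_rename]
    change _ = ((MvPolynomial.uniqueAlgEquiv K PUnit.{u + 1}).toAlgHom.comp (MvPolynomial.aeval _)) q
    congr 1
    ext i
    fin_cases i <;> simp
  rw [Polynomial.homogenize_eq_of_isHomogeneous hq.rename_isHomogeneous h,
    MvPolynomial.rename_rename, ← Equiv.coe_trans, Equiv.swap_swap]
  exact MvPolynomial.rename_id_apply q

/-- Modulo `x₀` only the leading term survives; this keeps the zero locus of a nonconstant monic
polynomial away from infinity. -/
theorem homogenization_of_monic [Nontrivial K] {p : Polynomial K} (hp : p.Monic) (h1 : p ≠ 1) :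
    ∃ H, homogenization p =
      MvPolynomial.X 1 ^ p.natDegree + MvPolynomial.X 0 * H := by
  have hn : p.natDegree ≠ 0 := fun h => h1 (hp.natDegree_eq_zero.1 h)
  obtain ⟨n, hn'⟩ := Nat.exists_eq_succ_of_ne_zero hn
  refine ⟨MvPolynomial.rename (Equiv.swap 0 1) (p.eraseLead.homogenize n), ?_⟩
  have hle : p.eraseLead.natDegree ≤ n := by
    have := p.eraseLead_natDegree_le; omega
  have h2 : p.homogenize p.natDegree =
      MvPolynomial.X 0 ^ p.natDegree + p.eraseLead.homogenize n * MvPolynomial.X 1 := by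
    have h4 : p = p.eraseLead + Polynomial.monomial p.natDegree 1 := by
      conv_lhs => rw [← p.eraseLead_add_monomial_natDegree_leadingCoeff, hp.leadingCoeff]
    have h5 := congr(Polynomial.homogenize $h4 p.natDegree)
    rw [Polynomial.homogenize_add] at h5
    have h3 : p.eraseLead.homogenize p.natDegree = p.eraseLead.homogenize n * MvPolynomial.X 1 := by
      have := Polynomial.homogenize_mul p.eraseLead 1 (m := n) (n := 1) hle (by simp)
      rw [hn', Nat.succ_eq_add_one]
      simpa using this
    rw [h5, h3, ← Polynomial.X_pow_eq_monomial, Polynomial.homogenize_X_pow le_rfl]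
    simp [add_comm]
  rw [homogenization, h2]
  simp [mul_comm]

theorem awayToPolynomial_mk (n : ℕ) (a : MvPolynomial (Fin 2) K)
    (ha : a ∈ MvPolynomial.homogeneousSubmodule (Fin 2) K (n • 1)) :
    awayToPolynomial K (HomogeneousLocalization.Away.mk _ (X_mem_homogeneousSubmodule K 0) n a ha)
      = dehomogenize K a := by
  rw [awayToPolynomial, RingHom.comp_apply, HomogeneousLocalization.algebraMap_apply,
    HomogeneousLocalization.Away.val_mk, Localization.mk_eq_mk', IsLocalization.Away.lift,
    IsLocalization.lift_mk'_spec]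
  simp [dehomogenize]

theorem awayToPolynomial_bijective : Function.Bijective (awayToPolynomial K) := by
  constructor
  · refine (injective_iff_map_eq_zero _).2 fun z hz => ?_
    obtain ⟨n, a, ha, rfl⟩ := HomogeneousLocalization.Away.mk_surjective _
      (X_mem_homogeneousSubmodule K 0) z
    rw [awayToPolynomial_mk] at hz
    have h0 := homogenization_eq_of_isHomogeneous (p := 0) ha (by rw [hz, map_zero])
    apply HomogeneousLocalization.val_injective
    rw [HomogeneousLocalization.Away.val_mk, HomogeneousLocalization.val_zero, ← h0]
    simp only [Polynomial.homogenize_zero, map_zero, Localization.mk_zero]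
  · intro q
    obtain ⟨p, rfl⟩ := (MvPolynomial.uniqueAlgEquiv K PUnit.{u + 1}).symm.surjective q
    refine ⟨HomogeneousLocalization.Away.mk _ (X_mem_homogeneousSubmodule K 0) p.natDegree
      (homogenization p) ?_, ?_⟩
    · simpa using isHomogeneous_homogenization p
    · rw [awayToPolynomial_mk, dehomogenize_homogenization]

theorem affineToProjectiveLine_mem_basicOpen {K : CommRingCat.{u}} {n : ℕ} (hn : 0 < n)
    {F : MvPolynomial (Fin 2) K}
    (hF : F ∈ MvPolynomial.homogeneousSubmodule (Fin 2) K n) (a : AffineLine (Spec K)) :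
    affineToProjectiveLine K a ∈ Proj.basicOpen (MvPolynomial.homogeneousSubmodule (Fin 2) K) F ↔
      dehomogenize K F ∉ ((AffineSpace.SpecIso PUnit.{u + 1} K).hom a).asIdeal := by
  have h := Proj.awayι_preimage_basicOpen (MvPolynomial.homogeneousSubmodule (Fin 2) K)
    (X_mem_homogeneousSubmodule K 0) Nat.one_pos hF hn
  let e : Spec (.of (MvPolynomial PUnit.{u + 1} K)) ⟶ Spec (.of _) :=
    Spec.map (CommRingCat.ofHom (awayToPolynomial K))
  let b := e ((AffineSpace.SpecIso PUnit.{u + 1} K).hom a)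
  have h1 : affineToProjectiveLine K a =
    Proj.awayι _ _ (X_mem_homogeneousSubmodule K 0) Nat.one_pos b := rfl
  have h2 : affineToProjectiveLine K a ∈
      Proj.basicOpen (MvPolynomial.homogeneousSubmodule (Fin 2) K) F ↔
      b ∈ Proj.awayι _ _ (X_mem_homogeneousSubmodule K 0) Nat.one_pos ⁻¹ᵁ
        Proj.basicOpen (MvPolynomial.homogeneousSubmodule (Fin 2) K) F := by
    rw [h1]; rfl
  rw [h2, h]
  change awayToPolynomial K (HomogeneousLocalization.Away.isLocalizationElem
    (X_mem_homogeneousSubmodule K 0) hF) ∉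
    ((AffineSpace.SpecIso PUnit.{u + 1} K).hom a).asIdeal ↔ _
  rw [HomogeneousLocalization.Away.isLocalizationElem, awayToPolynomial_mk, pow_one]

theorem range_affineToProjectiveLine (K : CommRingCat.{u}) :
    Set.range (affineToProjectiveLine K) =
      (Proj.basicOpen (MvPolynomial.homogeneousSubmodule (Fin 2) K) (MvPolynomial.X 0) :
        Set (ProjectiveLine K)) := by
  have : IsIso (CommRingCat.ofHom (awayToPolynomial K)) :=
    (ConcreteCategory.isIso_iff_bijective _).2 awayToPolynomial_bijective
  rw [← Proj.opensRange_awayι _ _ (X_mem_homogeneousSubmodule K 0) Nat.one_pos,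
    affineToProjectiveLine, ← Category.assoc, Scheme.Hom.comp_base, TopCat.coe_comp]
  exact (Scheme.Hom.surjective _).range_comp _

theorem compl_image_affineToProjectiveLine {K : CommRingCat.{u}} [IsDomain K] {p : Polynomial K}
    (hp : p.Monic) (h1 : p ≠ 1) {T : Set (AffineLine (Spec K))}
    (hT : ∀ a, a ∈ T ↔ (MvPolynomial.uniqueAlgEquiv K PUnit.{u + 1}).symm p ∈
      ((AffineSpace.SpecIso PUnit.{u + 1} K).hom a).asIdeal) :
    (Proj.basicOpen (MvPolynomial.homogeneousSubmodule (Fin 2) K) (homogenization p) :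
      Set (ProjectiveLine K)) = (affineToProjectiveLine K '' T)ᶜ := by
  have hn : 0 < p.natDegree := Nat.pos_of_ne_zero fun h => h1 (hp.natDegree_eq_zero.1 h)
  have key := affineToProjectiveLine_mem_basicOpen hn (isHomogeneous_homogenization p)
  rw [dehomogenize_homogenization] at key
  ext x
  constructor
  · rintro hx ⟨a, ha, rfl⟩
    exact (key a).1 hx ((hT a).1 ha)
  · intro hx
    by_cases h0 : x ∈ Proj.basicOpen (MvPolynomial.homogeneousSubmodule (Fin 2) K)
      (MvPolynomial.X 0)
    · have : x ∈ Set.range (affineToProjectiveLine K) := by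
        rw [range_affineToProjectiveLine]; exact h0
      obtain ⟨a, rfl⟩ := this
      exact (key a).2 fun h => hx ⟨a, (hT a).2 h, rfl⟩
    -- Off the chart `x₀` lies in the prime. If the homogenization did too, so would a power of
    -- `x₁`, and the prime would contain the irrelevant ideal.
    · obtain ⟨H, hH⟩ := homogenization_of_monic hp h1
      rw [Proj.mem_basicOpen, not_not] at h0
      by_contra hF
      have hF : homogenization p ∈ x.asHomogeneousIdeal := by simpa using hF
      have h2 : MvPolynomial.X 1 ∈ x.asHomogeneousIdeal.toIdeal := by
        refine x.isPrime.mem_of_pow_mem p.natDegree ?_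
        have hF' : homogenization p ∈ x.asHomogeneousIdeal.toIdeal := hF
        have h0' : MvPolynomial.X 0 ∈ x.asHomogeneousIdeal.toIdeal := h0
        have := sub_mem hF' (Ideal.mul_mem_right H _ h0')
        rwa [hH, add_sub_cancel_right] at this
      have h3 : Ideal.span (Set.range (MvPolynomial.X : Fin 2 → MvPolynomial (Fin 2) K)) ≤
          x.asHomogeneousIdeal.toIdeal := by
        rw [Ideal.span_le]
        rintro _ ⟨i, rfl⟩
        fin_cases i
        · exact h0
        · exact h2
      refine x.not_irrelevant_le fun a ha => h3 ?_
      change a ∈ MvPolynomial.idealOfVars (Fin 2) K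
      rw [HomogeneousIdeal.mem_irrelevant_iff] at ha
      rw [← pow_one (MvPolynomial.idealOfVars _ _), MvPolynomial.mem_pow_idealOfVars_iff']
      intro d hd
      have : d = 0 := by simpa [Finsupp.degree_eq_zero_iff] using hd
      subst this
      have h4 := congr(MvPolynomial.coeff 0 $ha)
      have h5 := MvPolynomial.coeff_homogeneousComponent 0 0 (φ := a)
      rw [if_pos (map_zero _)] at h5
      rw [MvPolynomial.coeff_zero, GradedRing.proj_apply] at h4
      rw [← h5, ← MvPolynomial.decomposition.decompose'_apply]
      exact h4

theorem eval₂_mul_of_isHomogeneous {σ R S : Type*} [CommSemiring R] [CommSemiring S] {d : ℕ}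
    {q : MvPolynomial σ R} (hq : q.IsHomogeneous d) {f : R →+* S} {g : σ → S} {a : S} :
    MvPolynomial.eval₂ f (fun i => g i * a) q = MvPolynomial.eval₂ f g q * a ^ d := by
  rw [MvPolynomial.eval₂_eq, MvPolynomial.eval₂_eq, Finset.sum_mul]
  refine Finset.sum_congr rfl fun m hm => ?_
  rw [mul_assoc, hq.degree_eq_sum_deg_support hm]
  simp only [mul_pow, Finset.prod_mul_distrib, Finset.prod_pow_eq_pow_sum]

/-- If `F` is divisible by homogeneous polynomials of coprime degrees, then the degree zero part
of the localization at `F` is a retract of the localization. -/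
theorem exists_retraction_away {F G₁ G₂ : MvPolynomial (Fin 2) K} {N n₁ n₂ : ℕ}
    (hF : F ∈ MvPolynomial.homogeneousSubmodule (Fin 2) K N)
    (hG₁ : G₁.IsHomogeneous n₁) (hG₂ : G₂.IsHomogeneous n₂)
    {K₁ K₂ : MvPolynomial (Fin 2) K} {m₁ m₂ : ℕ} (hK₁ : K₁.IsHomogeneous m₁)
    (hK₂ : K₂.IsHomogeneous m₂) (hF₁ : F = G₁ * K₁) (hF₂ : F = G₂ * K₂)
    (h₁ : n₁ + m₁ = N) (h₂ : n₂ + m₂ = N) (hn : n₁.Coprime n₂) (h1 : 1 < n₂) :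
    ∃ ψ : Localization.Away F →+*
        HomogeneousLocalization.Away (MvPolynomial.homogeneousSubmodule (Fin 2) K) F,
      ψ.comp (algebraMap _ _) = RingHom.id _ := by
  obtain ⟨a, -, ha⟩ := Nat.exists_mul_mod_eq_one_of_coprime hn h1
  -- Thus `G₁ ^ a / G₂ ^ b` is a homogeneous unit of degree one in the localization at `F`.
  obtain ⟨b, hb⟩ : ∃ b, n₁ * a = b * n₂ + 1 :=
    ⟨n₁ * a / n₂, by have := Nat.div_add_mod (n₁ * a) n₂; rw [ha] at this; linarith⟩
  let 𝒜 := MvPolynomial.homogeneousSubmodule (Fin 2) K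
  let ι : MvPolynomial (Fin 2) K →+* Localization.Away F := algebraMap _ _
  have hu : IsUnit (ι F) := IsLocalization.Away.algebraMap_isUnit F
  have hval (n : ℕ) (q) (hq : q ∈ 𝒜 (n • N)) :
      (HomogeneousLocalization.Away.mk 𝒜 hF n q hq).val * ι F ^ n = ι q := by
    rw [HomogeneousLocalization.Away.val_mk, Localization.mk_eq_mk', ← map_pow]
    exact IsLocalization.mk'_spec (Localization.Away F) q ⟨F ^ n, _⟩
  have hx (i : Fin 2) : MvPolynomial.X i * G₂ ^ b * K₁ ^ a ∈ 𝒜 (a • N) := by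
    have h := ((MvPolynomial.isHomogeneous_X K i).mul (hG₂.pow b)).mul (hK₁.pow a)
    have h' : 1 + n₂ * b + m₁ * a = a • N := by
      rw [smul_eq_mul, ← h₁]; linarith
    rwa [h'] at h
  -- This is `X i` divided by the unit of degree one, namely `X i * G₂ ^ b / G₁ ^ a`, written over
  -- `F ^ a` by means of `F = G₁ * K₁`.
  let x (i : Fin 2) := HomogeneousLocalization.Away.mk 𝒜 hF a _ (hx i)
  let ψ₀ : MvPolynomial (Fin 2) K →+* HomogeneousLocalization.Away 𝒜 F :=
    MvPolynomial.eval₂Hom ((HomogeneousLocalization.fromZeroRingHom 𝒜 _).comp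
      (algebraMap K (𝒜 0))) x
  have huG₁ : IsUnit (ι G₁) := isUnit_of_dvd_unit (map_dvd ι (hF₁ ▸ dvd_mul_right _ _)) hu
  have huK₁ : IsUnit (ι K₁) := isUnit_of_dvd_unit (map_dvd ι (hF₁ ▸ dvd_mul_left _ _)) hu
  have hψ₀ (d : ℕ) (q) (hq : q ∈ 𝒜 d) :
      (ψ₀ q).val * ι (G₁ ^ a) ^ d = ι (G₂ ^ b) ^ d * ι q := by
    let v : HomogeneousLocalization.Away 𝒜 F →+* Localization.Away F := algebraMap _ _
    have hC : v.comp ((HomogeneousLocalization.fromZeroRingHom 𝒜 _).comp (algebraMap K (𝒜 0))) =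
        ι.comp MvPolynomial.C := by
      ext c
      simp [v, ι, HomogeneousLocalization.fromZeroRingHom]
      rfl
    have hxv (i : Fin 2) : v (x i) * ι (G₁ ^ a) = ι (MvPolynomial.X i) * ι (G₂ ^ b) := by
      refine (huK₁.pow a).mul_right_cancel ?_
      have h := hval _ _ (hx i)
      have h5 : ι F = ι G₁ * ι K₁ := by rw [← map_mul, ← hF₁]
      rw [h5] at h
      simp only [map_mul, map_pow, mul_pow] at h ⊢
      rw [← h, ← mul_assoc]
      rfl
    have h1 : (ψ₀ q).val = MvPolynomial.eval₂ (ι.comp MvPolynomial.C) (fun i => v (x i)) q := by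
      change v (MvPolynomial.eval₂ _ _ q) = _
      rw [MvPolynomial.hom_eval₂, hC]
    rw [h1, ← eval₂_mul_of_isHomogeneous hq]
    simp_rw [hxv]
    rw [eval₂_mul_of_isHomogeneous hq, mul_comm]
    congr 1
    change _ = ι q
    conv_rhs => rw [← MvPolynomial.eval₂_eta q, MvPolynomial.hom_eval₂]
  -- The numerator of the inverse of `ψ₀ F`: that inverse is `(G₁ ^ a / G₂ ^ b) ^ N / F`, and `1 /
  -- G₂ = K₂ / F`.
  have hw : G₁ ^ (a * N) * K₂ ^ (b * N) ∈ 𝒜 ((b * N + 1) • N) := by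
    have h := (hG₁.pow (a * N)).mul (hK₂.pow (b * N))
    have h' : n₁ * (a * N) + m₂ * (b * N) = (b * N + 1) • N := by
      rw [smul_eq_mul, ← mul_assoc, hb]
      calc _ = b * N * (n₂ + m₂) + N := by ring
        _ = _ := by rw [h₂]; ring
    rwa [h'] at h
  let w := HomogeneousLocalization.Away.mk 𝒜 hF _ _ hw
  have hinj := HomogeneousLocalization.val_injective (𝒜 := 𝒜) (.powers F)
  have hunit : IsUnit (ψ₀ F) := by
    refine .of_mul_eq_one w (hinj ?_)
    rw [HomogeneousLocalization.val_mul, HomogeneousLocalization.val_one]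
    refine (((huG₁.pow a).pow N).mul (hu.pow (b * N + 1))).mul_right_cancel ?_
    have h3 := hψ₀ _ _ hF
    have h4 := hval _ _ hw
    have h5 : ι F = ι G₂ * ι K₂ := by rw [← map_mul, ← hF₂]
    simp only [map_mul, map_pow] at h3 h4 ⊢
    calc _ = ((ψ₀ F).val * (ι G₁ ^ a) ^ N) * (w.val * ι F ^ (b * N + 1)) := by ring
      _ = (ι G₂ * ι K₂) ^ (b * N) * ι F * ι G₁ ^ (a * N) := by rw [h3, h4]; ring
      _ = _ := by rw [← h5]; ring
  refine ⟨IsLocalization.Away.lift F hunit, ?_⟩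
  ext z
  obtain ⟨n, q, hq, rfl⟩ := HomogeneousLocalization.Away.mk_surjective _ hF z
  set z := HomogeneousLocalization.Away.mk 𝒜 hF n q hq
  suffices h : IsLocalization.Away.lift F hunit z.val = z from congr_arg _ h
  -- On an element `q / F ^ n` of degree zero the powers of the degree-one unit cancel between
  -- numerator and denominator.
  refine (hunit.pow n).mul_right_cancel ?_
  have h1 : IsLocalization.Away.lift F hunit z.val * ψ₀ F ^ n = ψ₀ q := by
    rw [← IsLocalization.Away.lift_eq (S := Localization.Away F) F hunit,
      ← IsLocalization.Away.lift_eq (S := Localization.Away F) F hunit, ← map_pow, ← map_mul]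
    exact congr_arg _ (hval n q hq)
  rw [h1]
  apply hinj
  rw [HomogeneousLocalization.val_mul, HomogeneousLocalization.val_pow]
  refine ((huG₁.pow a).pow (n * N)).mul_right_cancel ?_
  have h2 := hψ₀ _ _ hq
  have h3 := hψ₀ _ _ hF
  have h4 := hval n q hq
  simp only [map_pow, smul_eq_mul] at h2 h3 ⊢
  rw [h2, ← h4]
  calc _ = z.val * ((ι G₂ ^ b) ^ N * ι F) ^ n := by ring
    _ = z.val * ((ψ₀ F).val * (ι G₁ ^ a) ^ N) ^ n := by rw [h3]
    _ = _ := by ring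

/-- By functoriality the identity of the Picard group of `A` factors through that of `B`. -/
theorem subsingleton_commRingPic_of_retraction {A B : Type u} [CommRing A] [CommRing B]
    [Subsingleton (CommRing.Pic B)] (f : A →+* B) (g : B →+* A) (h : g.comp f = RingHom.id A) :
    Subsingleton (CommRing.Pic A) := by
  refine ⟨fun M N => ?_⟩
  rw [← CommRing.Pic.mapRingHom_id_apply (M := M), ← CommRing.Pic.mapRingHom_id_apply (M := N),
    ← h, ← CommRing.Pic.mapRingHom_mapRingHom, ← CommRing.Pic.mapRingHom_mapRingHom,
    Subsingleton.elim (CommRing.Pic.mapRingHom f M) (CommRing.Pic.mapRingHom f N)]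

theorem subsingleton_commRingPic_of_uniqueFactorizationMonoid (R : Type u) [CommRing R] [IsDomain R]
    [UniqueFactorizationMonoid R] : Subsingleton (CommRing.Pic R) :=
  have : IsGCDMonoid R := ⟨UniqueFactorizationMonoid.toGCDMonoid R⟩
  inferInstance

theorem pic_basicOpen_homogenization {K : CommRingCat.{u}} [IsDomain K]
    [UniqueFactorizationMonoid K] {p p₁ p₂ : Polynomial K} (hp : p ≠ 0)
    (h₁ : p₁ ∣ p) (h₂ : p₂ ∣ p) (hn : p₁.natDegree.Coprime p₂.natDegree) (h : 1 < p₂.natDegree)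
    (c : Pic (Proj.basicOpen (MvPolynomial.homogeneousSubmodule (Fin 2) K)
      (homogenization p)).toScheme) : c = 0 := by
  obtain ⟨q₁, rfl⟩ := h₁
  obtain ⟨q₂, hq₂⟩ := h₂
  have h0 := hq₂ ▸ hp
  have hd₁ := Polynomial.natDegree_mul (left_ne_zero_of_mul hp) (right_ne_zero_of_mul hp)
  have hd₂ := congr_arg Polynomial.natDegree hq₂
  rw [Polynomial.natDegree_mul (left_ne_zero_of_mul h0) (right_ne_zero_of_mul h0)] at hd₂
  have hF₁ := homogenization_mul (left_ne_zero_of_mul hp) (right_ne_zero_of_mul hp)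
  have hF₂ := congr_arg homogenization hq₂
  rw [homogenization_mul (left_ne_zero_of_mul h0) (right_ne_zero_of_mul h0)] at hF₂
  obtain ⟨ψ, hψ⟩ := exists_retraction_away (isHomogeneous_homogenization (p₁ * q₁))
    (isHomogeneous_homogenization p₁) (isHomogeneous_homogenization p₂)
    (isHomogeneous_homogenization q₁) (isHomogeneous_homogenization q₂) hF₁ hF₂ hd₁.symm
    hd₂.symm hn h
  have hF : homogenization (p₁ * q₁) ≠ 0 := by
    intro h
    have := dehomogenize_homogenization (p₁ * q₁)
    rw [h, map_zero] at this
    exact hp ((map_eq_zero_iff _ (AlgEquiv.injective _)).1 this.symm)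
  have hle : Submonoid.powers (homogenization (p₁ * q₁)) ≤ nonZeroDivisors _ :=
    powers_le_nonZeroDivisors_of_noZeroDivisors hF
  have : IsDomain (Localization.Away (homogenization (p₁ * q₁))) :=
    IsLocalization.isDomain_localization hle
  have : UniqueFactorizationMonoid (Localization.Away (homogenization (p₁ * q₁))) :=
    UniqueFactorizationMonoid.of_isLocalization (.powers (homogenization (p₁ * q₁))) _
  have : Subsingleton (CommRing.Pic (Localization.Away (homogenization (p₁ * q₁)))) :=
    subsingleton_commRingPic_of_uniqueFactorizationMonoid _
  have := subsingleton_commRingPic_of_retraction _ _ hψ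
  exact pic_eq_zero_of_iso_Spec (Proj.basicOpenIsoSpec _ _
    (isHomogeneous_homogenization (p₁ * q₁)) (by omega)) c

end ProjectiveLine

/-! ### Generators of finite étale algebras over finite fields. -/

section FiniteField

open Polynomial IntermediateField

/-- A non-generator lies in a proper subfield, whose degree `d` is at most half of the total, and is
a root of `X ^ q ^ d - X`. The bound is a geometric sum. -/
theorem ncard_adjoin_ne_top_lt (F L : Type*) [Field F] [Field L] [Finite F] [Finite L]
    [Algebra F L] :
    {x : L | F⟮x⟯ ≠ ⊤}.ncard < Nat.card F ^ (Module.finrank F L / 2 + 1) := by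
  classical
  set q := Nat.card F with hq
  have hq1 : 1 < q := Finite.one_lt_card
  have _ := Module.Finite.of_finite (R := F) (M := L)
  let T : Finset L := (Finset.Icc 1 (Module.finrank F L / 2)).biUnion fun d =>
    (X ^ q ^ d - X : L[X]).roots.toFinset
  have hT : T.card ≤ ∑ d ∈ Finset.Icc 1 (Module.finrank F L / 2), q ^ d := by
    refine Finset.card_biUnion_le.trans (Finset.sum_le_sum fun d hd => ?_)
    refine (Multiset.toFinset_card_le _).trans ((Polynomial.card_roots' _).trans ?_)
    rw [FiniteField.X_pow_card_pow_sub_X_natDegree_eq _ (by grind) hq1]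
  refine lt_of_le_of_lt ?_ (hT.trans_lt (Nat.geomSum_lt hq1 fun d hd => by
    rw [Finset.mem_Icc] at hd; omega))
  rw [← Set.ncard_coe_finset]
  refine Set.ncard_le_ncard (fun x hx => ?_)
  have h1 : Module.finrank F F⟮x⟯ * Module.finrank F⟮x⟯ L = Module.finrank F L :=
    Module.finrank_mul_finrank F F⟮x⟯ L
  have h2 : Module.finrank F⟮x⟯ L ≠ 1 := fun h => hx (IntermediateField.finrank_eq_one_iff_eq_top.1 h)
  have h3 : 0 < Module.finrank F⟮x⟯ L := Module.finrank_pos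
  have h4 : 0 < Module.finrank F F⟮x⟯ := Module.finrank_pos
  simp only [T, Finset.coe_biUnion, Set.mem_iUnion]
  refine ⟨Module.finrank F F⟮x⟯, ?_, ?_⟩
  · simp only [Finset.coe_Icc, Set.mem_Icc]
    refine ⟨h4, (Nat.le_div_iff_mul_le two_pos).2 ?_⟩
    rw [← h1]
    exact Nat.mul_le_mul_left _ (by omega)
  · have : x ^ q ^ Module.finrank F F⟮x⟯ = x := by
      have _ := Fintype.ofFinite F⟮x⟯
      have h5 := FiniteField.pow_card (⟨x, mem_adjoin_simple_self F x⟩ : F⟮x⟯)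
      rw [← Nat.card_eq_fintype_card, Module.natCard_eq_pow_finrank (K := F)] at h5
      exact congr_arg Subtype.val h5
    simp [this, FiniteField.X_pow_card_pow_sub_X_ne_zero L h4.ne' hq1]

/-- Non-generators are so few that more than `J * m` generators remain, where `m` is the degree, and
each minimal polynomial accounts for at most `m` of them. -/
theorem lt_ncard_image_minpoly (F L : Type*) [Field F] [Field L] [Finite F] [Finite L]
    [Algebra F L] {J : ℕ} (h3 : 3 ≤ Module.finrank F L)
    (hJ : J * Module.finrank F L < 2 ^ (Module.finrank F L - 1)) :
    J < ((minpoly F) '' {x : L | F⟮x⟯ = ⊤}).ncard := by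
  classical
  set m := Module.finrank F L with hm
  set q := Nat.card F with hq
  have hq1 : 1 < q := Finite.one_lt_card
  have _ := Module.Finite.of_finite (R := F) (M := L)
  have h1 : {x : L | F⟮x⟯ ≠ ⊤}.ncard < q ^ (m / 2 + 1) := ncard_adjoin_ne_top_lt F L
  have h2 : {x : L | F⟮x⟯ ≠ ⊤}.ncard + {x : L | F⟮x⟯ = ⊤}.ncard = q ^ m := by
    rw [hq, hm, ← Module.natCard_eq_pow_finrank (K := F) (V := L),
      ← Set.ncard_add_ncard_compl {x : L | F⟮x⟯ ≠ ⊤}]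
    congr 2
    ext; simp
  -- The comparison of exponents is where `3 ≤ m` enters; it fails for `m = 2`.
  have h4 : q ^ (m / 2 + 1) ≤ q ^ (m - 1) := Nat.pow_le_pow_right hq1.le (by omega)
  have h5 : q ^ m = q * q ^ (m - 1) := by rw [← pow_succ']; congr 1; omega
  have h6 : 2 * q ^ (m - 1) ≤ q * q ^ (m - 1) := Nat.mul_le_mul_right _ hq1
  have h7 : 2 ^ (m - 1) ≤ q ^ (m - 1) := Nat.pow_le_pow_left hq1 _
  have h8 : J * m < {x : L | F⟮x⟯ = ⊤}.ncard := by omega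
  have h9 : {x : L | F⟮x⟯ = ⊤}.ncard ≤ ((minpoly F) '' {x : L | F⟮x⟯ = ⊤}).ncard * m := by
    rw [Set.ncard_eq_toFinset_card _ (Set.toFinite _), Set.ncard_eq_toFinset_card _ (Set.toFinite _)]
    rw [mul_comm]
    refine Finset.card_le_mul_card_image_of_maps_to (f := minpoly F) (by simp; tauto) m ?_
    intro f hf
    obtain ⟨y, hy, rfl⟩ : ∃ y : L, F⟮y⟯ = ⊤ ∧ minpoly F y = f := by simpa using hf
    have hle : (Finset.filter (fun x => minpoly F x = minpoly F y)
        (Set.toFinite {x : L | F⟮x⟯ = ⊤}).toFinset) ⊆ ((minpoly F y).aroots L).toFinset := by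
      intro x hx
      rw [Finset.mem_filter] at hx
      rw [Multiset.mem_toFinset, mem_aroots, ← hx.2]
      exact ⟨minpoly.ne_zero (IsIntegral.of_finite F x), minpoly.aeval F x⟩
    refine (Finset.card_le_card hle).trans ((Multiset.toFinset_card_le _).trans ?_)
    refine (Polynomial.card_roots' _).trans ?_
    rw [natDegree_map]
    exact minpoly.natDegree_le y
  by_contra! h10
  have := Nat.mul_le_mul_right m h10
  omega

theorem exists_adjoin_singleton_pi_eq_top {F ι : Type*} [Field F] [Finite F] [Finite ι]
    (L : ι → Type*) [∀ i, Field (L i)] [∀ i, Algebra F (L i)] [∀ i, Finite (L i)] {J : ℕ}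
    (hι : Nat.card ι ≤ J) (h3 : ∀ i, 3 ≤ Module.finrank F (L i))
    (hJ : ∀ i, J * Module.finrank F (L i) < 2 ^ (Module.finrank F (L i) - 1)) :
    ∃ c : Π i, L i, Algebra.adjoin F {c} = ⊤ := by
  classical
  have _ (i) := Module.Finite.of_finite (R := F) (M := L i)
  have hfin (i) : ((minpoly F) '' {x : L i | F⟮x⟯ = ⊤}).Finite := Set.toFinite _
  have _ := Fintype.ofFinite ι
  -- Hall's theorem selects distinct minimal polynomials; its condition holds because each single
  -- set already has more elements than there are factors. Distinct monic irreducibles are coprime,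
  -- so the Chinese remainder theorem then applies.
  obtain ⟨f, hf, hft⟩ := (Finset.all_card_le_biUnion_card_iff_exists_injective
    fun i => (hfin i).toFinset).1 fun s => by
      obtain rfl | ⟨i, hi⟩ := s.eq_empty_or_nonempty
      · simp
      · refine (Finset.card_le_univ s).trans ?_
        rw [← Nat.card_eq_fintype_card]
        refine hι.trans ((lt_ncard_image_minpoly F (L i) (h3 i) (hJ i)).le.trans ?_)
        rw [Set.ncard_eq_toFinset_card _ (hfin i)]
        exact Finset.card_le_card (Finset.subset_biUnion_of_mem (fun i => (hfin i).toFinset) hi)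
  have hx (i) : ∃ x : L i, F⟮x⟯ = ⊤ ∧ minpoly F x = f i := by simpa using hft i
  choose x hx hxf using hx
  refine ⟨x, ?_⟩
  rw [Algebra.adjoin_singleton_eq_range_aeval, AlgHom.range_eq_top]
  intro y
  have hy (i) : ∃ p : F[X], aeval (x i) p = y i := by
    have h : Algebra.adjoin F {x i} = ⊤ := by
      rw [← IntermediateField.adjoin_simple_toSubalgebra_of_isAlgebraic (.of_finite F (x i)), hx,
        IntermediateField.top_toSubalgebra]
    rw [Algebra.adjoin_singleton_eq_range_aeval, AlgHom.range_eq_top] at h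
    exact h (y i)
  choose p hp using hy
  have hcop : Pairwise (Function.onFun IsCoprime fun i => Ideal.span {f i}) := fun i j hij => by
    rw [Function.onFun, Ideal.isCoprime_span_singleton_iff]
    have h1 : Irreducible (f i) := hxf i ▸ minpoly.irreducible (.of_finite F (x i))
    have h2 : Irreducible (f j) := hxf j ▸ minpoly.irreducible (.of_finite F (x j))
    refine (h1.coprime_iff_not_dvd).2 fun h => hij (hf ?_)
    refine Polynomial.eq_of_monic_of_associated ?_ ?_ (h1.associated_of_dvd h2 h)
    · exact hxf i ▸ minpoly.monic (.of_finite F (x i))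
    · exact hxf j ▸ minpoly.monic (.of_finite F (x j))
  obtain ⟨r, hr⟩ := Ideal.exists_forall_sub_mem_ideal hcop p
  refine ⟨r, ?_⟩
  ext i
  obtain ⟨g, hg⟩ := Ideal.mem_span_singleton.1 (hr i)
  have h1 : aeval x r i = aeval (x i) r :=
    (aeval_algHom_apply (Pi.evalAlgHom F L i) x r).symm
  rw [h1, ← hp i, sub_eq_iff_eq_add.1 hg, map_add, map_mul, ← hxf i, minpoly.aeval]
  simp

/-- A reduced Artinian ring is the product of its residue fields; dimension at most `J * n` with
factors of degree at least `n` leaves at most `J` factors. -/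
theorem exists_adjoin_singleton_eq_top (F C : Type*) [Field F] [Finite F] [CommRing C]
    [Algebra F C] [Module.Finite F C] [IsReduced C] {J n : ℕ} (hn : 3 ≤ n)
    (hJ : ∀ m ≥ n, J * m < 2 ^ (m - 1)) (hdim : Module.finrank F C ≤ J * n)
    (hres : ∀ P : Ideal C, P.IsMaximal → n ≤ Module.finrank F (C ⧸ P)) :
    ∃ c : C, Algebra.adjoin F {c} = ⊤ := by
  have : IsArtinianRing C := IsArtinianRing.of_finite F C
  have (I : MaximalSpectrum C) : Finite (C ⧸ I.asIdeal) := Module.finite_of_finite F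
  let _ (I : MaximalSpectrum C) : Field (C ⧸ I.asIdeal) := Ideal.Quotient.field _
  let e : C ≃ₐ[F] Π I : MaximalSpectrum C, C ⧸ I.asIdeal :=
    (IsArtinianRing.equivPi C).restrictScalars F
  have hfin := e.toLinearEquiv.finrank_eq
  cases nonempty_fintype (MaximalSpectrum C)
  rw [Module.finrank_pi_fintype] at hfin
  have hcard : Fintype.card (MaximalSpectrum C) * n ≤ Module.finrank F C := by
    rw [hfin, ← smul_eq_mul]
    exact Finset.card_nsmul_le_sum _ _ _ fun I _ => hres _ I.isMaximal
  obtain ⟨c, hc⟩ := exists_adjoin_singleton_pi_eq_top (F := F)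
    (fun I : MaximalSpectrum C => C ⧸ I.asIdeal) (J := J)
    (by rw [Nat.card_eq_fintype_card]; exact Nat.le_of_mul_le_mul_right (hcard.trans hdim) (by omega))
    (fun I => hn.trans (hres _ I.isMaximal)) (fun I => hJ _ (hres _ I.isMaximal))
  refine ⟨e.symm c, ?_⟩
  have := congr_arg (Subalgebra.map e.symm.toAlgHom) hc
  rw [AlgHom.map_adjoin, Set.image_singleton] at this
  rw [Algebra.map_top, (AlgHom.range_eq_top _).2 e.symm.surjective] at this
  exact this

end FiniteField

/-! ### Lifting generators from the residue fields of a semi-local ring. -/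

section Semilocal

theorem mem_smul_top_of_one_tmul_eq_zero {R M : Type*} [CommRing R] [AddCommGroup M] [Module R M]
    {I : Ideal R} {y : M} (h : (1 : R ⧸ I) ⊗ₜ[R] y = 0) : y ∈ I • (⊤ : Submodule R M) := by
  have := congr_arg (TensorProduct.quotTensorEquivQuotSMul M I) h
  rw [map_zero, ← map_one (Ideal.Quotient.mk I),
    TensorProduct.quotTensorEquivQuotSMul_mk_tmul, one_smul] at this
  exact (Submodule.Quotient.mk_eq_zero _).1 this

theorem exists_adjoin_singleton_eq_top_of_maximalSpectrum {O D : Type*} [CommRing O] [CommRing D]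
    [Algebra O D] [Module.Finite O D] [Finite (MaximalSpectrum O)]
    (h : ∀ m : Ideal O, m.IsMaximal →
      ∃ c : (O ⧸ m) ⊗[O] D, Algebra.adjoin (O ⧸ m) {c} = ⊤) :
    ∃ d : D, Algebra.adjoin O {d} = ⊤ := by
  classical
  cases nonempty_fintype (MaximalSpectrum O)
  have hc (m : MaximalSpectrum O) :
      ∃ d : D, Algebra.adjoin (O ⧸ m.asIdeal) {(1 : O ⧸ m.asIdeal) ⊗ₜ[O] d} = ⊤ := by
    obtain ⟨c, hc⟩ := h m.asIdeal m.isMaximal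
    obtain ⟨d, rfl⟩ := Algebra.TensorProduct.includeRight_surjective D
      (Ideal.Quotient.mk_surjective (I := m.asIdeal)) c
    exact ⟨d, hc⟩
  choose d₀ hd₀ using hc
  have hcop : Pairwise (Function.onFun IsCoprime fun m : MaximalSpectrum O => m.asIdeal) :=
    fun m n hmn => Ideal.isCoprime_of_isMaximal fun h => hmn (MaximalSpectrum.ext h)
  choose ε hε using fun m : MaximalSpectrum O =>
    Ideal.exists_forall_sub_mem_ideal hcop (Pi.single m (1 : O))
  -- The coefficient `ε m` is one modulo `m` and zero modulo the other maximal ideals, so `d`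
  -- reduces to the chosen generator at every `m`.
  let d := ∑ m, ε m • d₀ m
  have hd (m : MaximalSpectrum O) :
      (1 : O ⧸ m.asIdeal) ⊗ₜ[O] d = (1 : O ⧸ m.asIdeal) ⊗ₜ[O] d₀ m := by
    have hs (n : MaximalSpectrum O) : (1 : O ⧸ m.asIdeal) ⊗ₜ[O] (ε n • d₀ n) =
        Ideal.Quotient.mk m.asIdeal (ε n) ⊗ₜ[O] d₀ n := by
      rw [TensorProduct.tmul_smul, TensorProduct.smul_tmul', Algebra.smul_def, mul_one]
      rfl
    simp only [d, TensorProduct.tmul_sum, hs]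
    rw [Finset.sum_eq_single m]
    · rw [(Ideal.Quotient.eq (I := m.asIdeal)).2 (hε m m), Pi.single_eq_same, map_one]
    · intro n _ hn
      rw [(Ideal.Quotient.eq (I := m.asIdeal)).2 (hε n m), Pi.single_eq_of_ne' hn, map_zero,
        TensorProduct.zero_tmul]
    · exact fun h => absurd (Finset.mem_univ m) h
  refine ⟨d, ?_⟩
  let S := (Algebra.adjoin O {d}).toSubmodule
  -- Since `d` generates modulo `m`, `D ⧸ S` equals `m` times itself; Nakayama gives an annihilator
  -- congruent to one modulo `m`.
  have key (m : Ideal O) (hm : m.IsMaximal) : ¬ Module.annihilator O (D ⧸ S) ≤ m := by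
    intro hle
    have hfg : (⊤ : Submodule O (D ⧸ S)) ≤ m • ⊤ := by
      rw [← Submodule.range_mkQ S, ← Submodule.map_top, ← Submodule.map_smul'']
      rintro _ ⟨y, -, rfl⟩
      have hy : (1 : O ⧸ m) ⊗ₜ[O] y ∈ Algebra.adjoin (O ⧸ m) {(1 : O ⧸ m) ⊗ₜ[O] d} := by
        rw [hd ⟨m, hm⟩, hd₀ ⟨m, hm⟩]; trivial
      rw [Algebra.adjoin_singleton_eq_range_aeval] at hy
      obtain ⟨p, hp⟩ := hy
      obtain ⟨p, rfl⟩ := Polynomial.map_surjective _ (Ideal.Quotient.mk_surjective (I := m)) p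
      have hp' : (1 : O ⧸ m) ⊗ₜ[O] (y - Polynomial.aeval d p) = 0 := by
        rw [TensorProduct.tmul_sub, ← hp, sub_eq_zero]
        change Polynomial.aeval _ (Polynomial.map (algebraMap O (O ⧸ m)) p) = _
        rw [Polynomial.aeval_map_algebraMap]
        exact Polynomial.aeval_algHom_apply
          (Algebra.TensorProduct.includeRight : D →ₐ[O] (O ⧸ m) ⊗[O] D) d p
      refine ⟨_, mem_smul_top_of_one_tmul_eq_zero hp', ?_⟩
      rw [map_sub, sub_eq_self, Submodule.mkQ_apply, Submodule.Quotient.mk_eq_zero]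
      exact Polynomial.aeval_mem_adjoin_singleton O d
    obtain ⟨r, hr, hr0⟩ := Submodule.exists_sub_one_mem_and_smul_eq_zero_of_fg_of_le_smul m ⊤
      Module.Finite.fg_top hfg
    have hrm : r ∈ m := hle (Module.mem_annihilator.2 fun x => hr0 x trivial)
    refine hm.ne_top ((Ideal.eq_top_iff_one m).2 ?_)
    have := sub_mem hrm hr
    rwa [sub_sub_cancel] at this
  have htop : Module.annihilator O (D ⧸ S) = ⊤ := by
    by_contra h
    obtain ⟨m, hm, hle⟩ := Ideal.exists_le_maximal _ h
    exact key m hm hle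
  have := Module.annihilator_eq_top_iff.1 htop
  rw [Submodule.Quotient.subsingleton_iff] at this
  exact Algebra.toSubmodule_eq_top.1 this

end Semilocal

/-! ### Choice of the two field extensions. -/

section FieldExtensions

/-- Any residue field of the tensor product has degree divisible by both coprime degrees, hence at
least the full dimension, so the maximal ideal is zero. -/
theorem isField_tensorProduct_of_coprime (k κ l : Type*) [Field k] [Field κ] [Field l]
    [Algebra k κ] [Algebra k l] [FiniteDimensional k κ] [FiniteDimensional k l]
    (h : (Module.finrank k κ).Coprime (Module.finrank k l)) : IsField (κ ⊗[k] l) := by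
  obtain ⟨P, hP⟩ := Ideal.exists_maximal (κ ⊗[k] l)
  let _ := Ideal.Quotient.field P
  have h1 : Module.finrank k κ ∣ Module.finrank k ((κ ⊗[k] l) ⧸ P) :=
    ⟨_, (Module.finrank_mul_finrank k κ _).symm⟩
  have h2 : Module.finrank k l ∣ Module.finrank k ((κ ⊗[k] l) ⧸ P) := by
    let φ : l →ₐ[k] (κ ⊗[k] l) ⧸ P :=
      (Ideal.Quotient.mkₐ k P).comp Algebra.TensorProduct.includeRight
    let _ := φ.toRingHom.toAlgebra
    have : IsScalarTower k l ((κ ⊗[k] l) ⧸ P) := .of_algebraMap_eq' φ.comp_algebraMap.symm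
    exact ⟨_, (Module.finrank_mul_finrank k l _).symm⟩
  have h3 : Module.finrank k (κ ⊗[k] l) ≤ Module.finrank k ((κ ⊗[k] l) ⧸ P) := by
    rw [Module.finrank_tensorProduct]
    exact Nat.le_of_dvd Module.finrank_pos (h.mul_dvd_of_dvd_of_dvd h1 h2)
  have h4 : Function.Injective (Ideal.Quotient.mkₐ k P).toLinearMap :=
    (LinearMap.injective_iff_surjective_of_finrank_eq_finrank
      (h3.antisymm (LinearMap.finrank_le_finrank_of_surjective
        (f := (Ideal.Quotient.mkₐ k P).toLinearMap) (Ideal.Quotient.mkₐ_surjective k P)))).2 (Ideal.Quotient.mkₐ_surjective k P)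
  have h5 : P = ⊥ := by
    rw [← Ideal.mk_ker (I := P)]
    exact (RingHom.injective_iff_ker_eq_bot _).1 h4
  subst h5
  exact Ring.isField_iff_maximal_bot.2 hP

theorem finrank_le_of_algHom {k κ l L : Type*} [Field k] [Field κ] [Field l] [CommRing L]
    [Nontrivial L] [Algebra k κ] [Algebra k l] [Algebra k L] [Algebra κ L] [IsScalarTower k κ L]
    [Module.Finite κ L] (h : IsField (κ ⊗[k] l)) (φ : l →ₐ[k] L) :
    Module.finrank k l ≤ Module.finrank κ L := by
  let Φ : κ ⊗[k] l →ₐ[κ] L := Algebra.TensorProduct.lift (Algebra.ofId κ L) φ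
    fun _ _ => Commute.all _ _
  let _ := h.toField
  have hΦ : Function.Injective Φ := RingHom.injective (Φ : κ ⊗[k] l →+* L)
  rw [← Module.finrank_baseChange (R := κ) (S := k) (M' := l)]
  exact LinearMap.finrank_le_finrank_of_injective (f := Φ.toLinearMap) hΦ

theorem exists_forall_mul_lt_two_pow (M : ℕ) : ∃ N : ℕ, ∀ m ≥ N, M * m < 2 ^ (m - 1) := by
  -- With `j = (m - 1) / 2` one has `2 ^ (m - 1) ≥ (j + 1) ^ 2` and `M * m ≤ 2 * M * (j + 1)`; the
  -- threshold forces `j ≥ 2 * M`.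
  refine ⟨4 * M + 2, fun m hm => ?_⟩
  obtain ⟨j, hj | hj⟩ : ∃ j, m = 2 * j + 1 ∨ m = 2 * j + 2 := ⟨(m - 1) / 2, by omega⟩
  all_goals
    have h1 : j + 1 ≤ 2 ^ j := Nat.lt_two_pow_self
    have h2 : (2 ^ j) * (2 ^ j) ≤ 2 ^ (m - 1) := by
      rw [← pow_add]; exact Nat.pow_le_pow_right two_pos (by omega)
    subst hj
    nlinarith

/-- Bertrand's postulate gives `q ≤ 2 * p`, which keeps the number of residue fields to be separated
bounded independently of `p`. -/
theorem exists_primes (N M : ℕ) : ∃ p q : ℕ, p.Prime ∧ q.Prime ∧ N < p ∧ p < q ∧ q ≤ 2 * p ∧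
    ∀ m ≥ p, M * m < 2 ^ (m - 1) := by
  obtain ⟨N', hN'⟩ := exists_forall_mul_lt_two_pow M
  obtain ⟨p, hp, hpp⟩ := Nat.exists_infinite_primes (N + 1 + N')
  obtain ⟨q, hq, hpq, hq2⟩ := Nat.exists_prime_lt_and_le_two_mul p hpp.ne_zero
  exact ⟨p, q, hpp, hq, by omega, hpq, hq2, fun m hm => hN' m (by omega)⟩

theorem exists_extension_of_finrank_eq (k : Type u) [Field k] [Finite k] (n : ℕ) (hn : n ≠ 0) :
    ∃ (l : Type u) (_ : Field l) (_ : Algebra k l) (_ : FiniteDimensional k l),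
      Module.finrank k l = n := by
  have : NeZero n := ⟨hn⟩
  have : Fact (ringChar k).Prime := ⟨CharP.char_is_prime k _⟩
  let l := FiniteField.Extension k (ringChar k) n
  refine ⟨ULift.{u} l, inferInstance, inferInstance, inferInstance, ?_⟩
  rw [ULift.moduleEquiv.finrank_eq]
  exact FiniteField.finrank_extension k (ringChar k) n

theorem isReduced_tensor_prod {κ O B₁ B₂ : Type*} [Field κ] [CommRing O] [CommRing B₁]
    [CommRing B₂] [Algebra O κ] [Algebra O B₁] [Algebra O B₂] [Module.Finite O B₁]
    [Module.Finite O B₂] [Algebra.FormallyUnramified O B₁] [Algebra.FormallyUnramified O B₂] :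
    IsReduced (κ ⊗[O] (B₁ × B₂)) := by
  have := Algebra.FormallyUnramified.isReduced_of_field κ (κ ⊗[O] B₁)
  have := Algebra.FormallyUnramified.isReduced_of_field κ (κ ⊗[O] B₂)
  exact isReduced_of_injective (Algebra.TensorProduct.prodRight O κ κ B₁ B₂)
    (AlgEquiv.injective _)

theorem finrank_tensor_tensor {k κ O B l : Type*} [Field k] [Field κ] [CommRing O] [CommRing B]
    [Algebra k O] [Algebra O κ] [Algebra k κ] [IsScalarTower k O κ] [Algebra O B] [Algebra k B]
    [IsScalarTower k O B] [Field l] [Algebra k l] :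
    Module.finrank κ (κ ⊗[O] (B ⊗[k] l)) =
      Module.finrank κ (κ ⊗[O] B) * Module.finrank k l := by
  rw [← (TensorProduct.AlgebraTensorModule.assoc k O κ κ B l).finrank_eq,
    Module.finrank_tensorProduct]

/-- The two idempotents of the product map to complementary idempotents of a domain, so one of them
maps to one. -/
theorem nonempty_algHom_of_prod {k R₁ R₂ L : Type*} [CommRing k] [CommRing R₁] [CommRing R₂]
    [CommRing L] [IsDomain L] [Algebra k R₁] [Algebra k R₂] [Algebra k L]
    (φ : R₁ × R₂ →ₐ[k] L) : Nonempty (R₁ →ₐ[k] L) ∨ Nonempty (R₂ →ₐ[k] L) := by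
  have he : φ (1, 0) * φ (0, 1) = 0 := by
    rw [← map_mul, show ((1 : R₁), (0 : R₂)) * (0, 1) = 0 by ext <;> simp, map_zero]
  have he' : φ (1, 0) + φ (0, 1) = 1 := by
    rw [← map_add, show ((1 : R₁), (0 : R₂)) + (0, 1) = 1 by ext <;> simp, map_one]
  obtain h | h := mul_eq_zero.1 he
  · right
    rw [h, zero_add] at he'
    exact ⟨AlgHom.ofLinearMap (φ.toLinearMap ∘ₗ LinearMap.inr k R₁ R₂) he'
      fun x y => by simp [← map_mul]⟩
  · left
    rw [h, add_zero] at he'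
    exact ⟨AlgHom.ofLinearMap (φ.toLinearMap ∘ₗ LinearMap.inl k R₁ R₂) he'
      fun x y => by simp [← map_mul]⟩

/-- Unramifiedness makes the algebra reduced. Its residue fields contain some `κ ⊗ k_r`, and its
dimension is at most `N * ([k₁ : k] + [k₂ : k]) ≤ 3 * N * [k₁ : k]`. -/
theorem exists_generator_residue_tensor {k κ O B k₁ k₂ : Type*} [Field k] [Finite k] [Field κ]
    [CommRing O] [CommRing B] [Algebra k O] [Algebra O κ] [Algebra k κ] [IsScalarTower k O κ]
    [Finite κ] [Algebra O B] [Algebra k B] [IsScalarTower k O B] [Module.Finite O B]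
    [Algebra.FormallyUnramified O B] [Field k₁] [Field k₂] [Algebra k k₁] [Algebra k k₂]
    [FiniteDimensional k k₁] [FiniteDimensional k k₂]
    (h₁ : IsField (κ ⊗[k] k₁)) (h₂ : IsField (κ ⊗[k] k₂))
    (h : Module.finrank k k₁ ≤ Module.finrank k k₂)
    (h' : Module.finrank k k₂ ≤ 2 * Module.finrank k k₁)
    (h3 : 3 ≤ Module.finrank k k₁) {N : ℕ} (hN : Module.finrank κ (κ ⊗[O] B) ≤ N)
    (hJ : ∀ m ≥ Module.finrank k k₁, 3 * N * m < 2 ^ (m - 1)) :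
    ∃ c : κ ⊗[O] ((B ⊗[k] k₁) × (B ⊗[k] k₂)), Algebra.adjoin κ {c} = ⊤ := by
  have : Algebra.FormallyUnramified k k₁ := .of_isSeparable k k₁
  have : Algebra.FormallyUnramified k k₂ := .of_isSeparable k k₂
  have : Algebra.FormallyUnramified O (B ⊗[k] k₁) := .comp O B _
  have : Algebra.FormallyUnramified O (B ⊗[k] k₂) := .comp O B _
  have : Module.Finite O (B ⊗[k] k₁) := .trans B _
  have : Module.Finite O (B ⊗[k] k₂) := .trans B _
  have := isReduced_tensor_prod (κ := κ) (O := O) (B₁ := B ⊗[k] k₁) (B₂ := B ⊗[k] k₂)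
  refine exists_adjoin_singleton_eq_top κ _ h3 hJ ?_ ?_
  · rw [(TensorProduct.prodRight O κ κ (B ⊗[k] k₁) (B ⊗[k] k₂)).finrank_eq, Module.finrank_prod,
      finrank_tensor_tensor, finrank_tensor_tensor, ← mul_add]
    refine (Nat.mul_le_mul hN (by omega : _ ≤ 3 * Module.finrank k k₁)).trans (le_of_eq (by ring))
  · intro P hP
    let L := (κ ⊗[O] ((B ⊗[k] k₁) × (B ⊗[k] k₂))) ⧸ P
    let _ : Field L := Ideal.Quotient.field P
    let φ : (B ⊗[k] k₁) × (B ⊗[k] k₂) →ₐ[k] L :=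
      ((Ideal.Quotient.mkₐ O P).comp Algebra.TensorProduct.includeRight).restrictScalars k
    obtain ⟨⟨φ⟩⟩ | ⟨⟨φ⟩⟩ := nonempty_algHom_of_prod φ
    · exact finrank_le_of_algHom h₁ (φ.comp Algebra.TensorProduct.includeRight)
    · exact h.trans (finrank_le_of_algHom h₂ (φ.comp Algebra.TensorProduct.includeRight))

theorem exists_field_extensions (k : Type u) {O B : Type u} [Field k] [Finite k] [CommRing O]
    [CommRing B] [Algebra k O] [Algebra O B] [Algebra k B] [IsScalarTower k O B]
    [Module.Finite O B] [Algebra.FormallyUnramified O B] [Finite (MaximalSpectrum O)]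
    (hO : ∀ m : Ideal O, m.IsMaximal → Finite (O ⧸ m)) (N : ℕ) :
    ∃ (k₁ k₂ : Type u) (_ : Field k₁) (_ : Field k₂) (_ : Algebra k k₁) (_ : Algebra k k₂)
      (_ : FiniteDimensional k k₁) (_ : FiniteDimensional k k₂),
      Nat.Coprime (Module.finrank k k₁) (Module.finrank k k₂) ∧
      1 < Module.finrank k k₂ ∧ N < Module.finrank k k₁ ∧ N < Module.finrank k k₂ ∧
      (∀ m : Ideal O, m.IsMaximal → IsField ((O ⧸ m) ⊗[k] k₁) ∧ IsField ((O ⧸ m) ⊗[k] k₂)) ∧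
      ∃ d : (B ⊗[k] k₁) × (B ⊗[k] k₂), Algebra.adjoin O {d} = ⊤ := by
  obtain ⟨M₁, hM₁⟩ := (Set.finite_range fun m : MaximalSpectrum O =>
    Module.finrank k (O ⧸ m.asIdeal)).bddAbove
  obtain ⟨M₂, hM₂⟩ := (Set.finite_range fun m : MaximalSpectrum O =>
    Module.finrank (O ⧸ m.asIdeal) ((O ⧸ m.asIdeal) ⊗[O] B)).bddAbove
  -- Exceeding `M₁` makes the primes coprime to all residue degrees of `O`, exceeding `2` meets the
  -- bound `3 ≤ p`, and `3 * M₂` bounds the number of residue fields at each maximal ideal.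
  obtain ⟨p, q, hp, hq, hNp, hpq, hqp, hJ⟩ := exists_primes (N + M₁ + 2) (3 * M₂)
  obtain ⟨k₁, _, _, _, rfl⟩ := exists_extension_of_finrank_eq k p hp.ne_zero
  obtain ⟨k₂, _, _, _, rfl⟩ := exists_extension_of_finrank_eq k q hq.ne_zero
  have hfield (m : Ideal O) (hm : m.IsMaximal) :
      IsField ((O ⧸ m) ⊗[k] k₁) ∧ IsField ((O ⧸ m) ⊗[k] k₂) := by
    let _ := Ideal.Quotient.field m
    have := hO m hm
    have : Module.Finite k (O ⧸ m) := .of_finite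
    have h0 : 0 < Module.finrank k (O ⧸ m) := Module.finrank_pos
    have h1 : Module.finrank k (O ⧸ m) ≤ M₁ := hM₁ ⟨⟨m, hm⟩, rfl⟩
    exact ⟨isField_tensorProduct_of_coprime k _ k₁ (Nat.coprime_of_lt_prime h0.ne' (by omega) hp).symm,
      isField_tensorProduct_of_coprime k _ k₂ (Nat.coprime_of_lt_prime h0.ne' (by omega) hq).symm⟩
  refine ⟨k₁, k₂, _, _, _, _, inferInstance, inferInstance, (Nat.coprime_primes hp hq).2 hpq.ne,
    hq.one_lt, by omega, by omega, hfield, ?_⟩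
  have : Module.Finite O (B ⊗[k] k₁) := .trans B _
  have : Module.Finite O (B ⊗[k] k₂) := .trans B _
  refine exists_adjoin_singleton_eq_top_of_maximalSpectrum fun m hm => ?_
  let _ := Ideal.Quotient.field m
  have := hO m hm
  exact exists_generator_residue_tensor (hfield m hm).1 (hfield m hm).2 hpq.le hqp (by omega)
    (hM₂ ⟨⟨m, hm⟩, rfl⟩) hJ

end FieldExtensions

/-! ### Maximal ideals and residue fields of the semi-local ring. -/

section SemilocalRing

/-- Elements of `M` become units, so the contraction of `m` lies in the union of the ideals in `T`;
prime avoidance puts it inside one of them, and maximality of `m` gives equality. -/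
theorem under_mem_of_isMaximal {A O : Type*} [CommRing A] [CommRing O] [Algebra A O]
    (M : Submonoid A) [IsLocalization M O] {T : Finset (Ideal A)} (hT : ∀ P ∈ T, P.IsMaximal)
    (hM : ∀ f, f ∈ M ↔ ∀ P ∈ T, f ∉ P) {m : Ideal O} (hm : m.IsMaximal) : m.under A ∈ T := by
  classical
  have hsub : ((m.under A : Ideal A) : Set A) ⊆ ⋃ P ∈ (T : Set (Ideal A)), (P : Set A) := by
    intro f hf
    by_contra h
    have hfM : f ∈ M := (hM f).2 fun P hP hfP => h (Set.mem_biUnion hP hfP)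
    exact hm.ne_top (Ideal.eq_top_of_isUnit_mem _ hf (IsLocalization.map_units O ⟨f, hfM⟩))
  obtain ⟨P, hP, hle⟩ := (Ideal.subset_union_prime (f := id) ⊥ ⊥
    fun P hP _ _ => (hT P hP).isPrime).1 hsub
  have hdisj : Disjoint (M : Set A) P :=
    Set.disjoint_left.2 fun f hf => (hM f).1 hf P hP
  have hne : P.map (algebraMap A O) ≠ ⊤ :=
    (IsLocalization.map_algebraMap_ne_top_iff_disjoint M O P).2 hdisj
  have h1 : m = P.map (algebraMap A O) := by
    refine hm.eq_of_le hne ?_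
    rw [← IsLocalization.map_under M O m]
    exact Ideal.map_mono hle
  have h2 : P = m.under A :=
    (hT P hP).eq_of_le (hm.isPrime.under A).ne_top (h1 ▸ Ideal.le_comap_map)
  exact h2 ▸ hP

theorem finite_maximalSpectrum_of_isLocalization {A O : Type*} [CommRing A] [CommRing O]
    [Algebra A O] (M : Submonoid A) [IsLocalization M O] {T : Finset (Ideal A)}
    (hT : ∀ P ∈ T, P.IsMaximal) (hM : ∀ f, f ∈ M ↔ ∀ P ∈ T, f ∉ P) :
    Finite (MaximalSpectrum O) := by
  refine Finite.of_injective (β := T)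
    (fun m => ⟨m.asIdeal.under A, under_mem_of_isMaximal M hT hM m.isMaximal⟩) fun m n h => ?_
  have h' : m.asIdeal.under A = n.asIdeal.under A := congr_arg Subtype.val h
  apply MaximalSpectrum.ext
  rw [← IsLocalization.map_under M O m.asIdeal, h', IsLocalization.map_under M O]

theorem finite_quotient_of_isMaximal (k : Type*) {A : Type*} [Field k] [Finite k] [CommRing A]
    [Algebra k A] [Algebra.FiniteType k A] {P : Ideal A} (hP : P.IsMaximal) : Finite (A ⧸ P) := by
  let _ := Ideal.Quotient.field P
  have := finite_of_finite_type_of_isJacobsonRing k (A ⧸ P)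
  exact Module.finite_of_finite k

theorem finite_quotient_of_isLocalization (k : Type*) {A O : Type*} [Field k] [Finite k]
    [CommRing A] [Algebra k A] [Algebra.FiniteType k A] [CommRing O] [Algebra A O]
    (M : Submonoid A) [IsLocalization M O] {T : Finset (Ideal A)}
    (hT : ∀ P ∈ T, P.IsMaximal) (hM : ∀ f, f ∈ M ↔ ∀ P ∈ T, f ∉ P) {m : Ideal O}
    (hm : m.IsMaximal) : Finite (O ⧸ m) := by
  have h1 := hT _ (under_mem_of_isMaximal M hT hM hm)
  have := finite_quotient_of_isMaximal k h1
  exact Finite.of_surjective _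
    (IsLocalization.surjective_quotientMap_of_maximal_of_localization M O (I := m)
      (H := le_rfl) h1)

theorem mem_basicOpen_iff_notMem {X : Scheme.{u}} [IsAffine X] (x : X) (f : Γ(X, ⊤)) :
    x ∈ X.basicOpen f ↔ f ∉ (X.isoSpec.hom x).asIdeal := by
  rw [← X.toSpecΓ_preimage_basicOpen f]
  rfl

theorem isMaximal_asIdeal_of_isClosed {X : Scheme.{u}} [IsAffine X] {x : X}
    (hx : IsClosed ({x} : Set X)) : (X.isoSpec.hom x).asIdeal.IsMaximal := by
  refine (PrimeSpectrum.isClosed_singleton_iff_isMaximal _).1 ?_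
  have := X.isoSpec.hom.homeomorph.isClosedMap _ hx
  rw [Set.image_singleton] at this
  exact this

theorem finite_semilocal {k : Type u} [Field k] [Finite k] {X : Scheme.{u}} [IsAffine X]
    (π : X ⟶ Spec (CommRingCat.of k)) [LocallyOfFiniteType π]
    (s : Finset X) (hcl : ∀ x ∈ s, IsClosed ({x} : Set X)) :
    Finite (MaximalSpectrum (Localization (nonvanishing X s))) ∧
      ∀ m : Ideal (Localization (nonvanishing X s)), m.IsMaximal →
        Finite (Localization (nonvanishing X s) ⧸ m) := by
  classical
  let T : Finset (Ideal Γ(X, ⊤)) := s.image fun x => (X.isoSpec.hom x).asIdeal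
  have hT : ∀ P ∈ T, P.IsMaximal := by
    intro P hP
    obtain ⟨x, hx, rfl⟩ := Finset.mem_image.1 hP
    exact isMaximal_asIdeal_of_isClosed (hcl x hx)
  have hM : ∀ f, f ∈ nonvanishing X s ↔ ∀ P ∈ T, f ∉ P := by
    intro f
    simp only [T, Finset.forall_mem_image, ← mem_basicOpen_iff_notMem]
    rfl
  have hft : (π.appTop.hom.comp (Scheme.ΓSpecIso (.of k)).inv.hom).FiniteType := by
    refine RingHom.FiniteType.comp ?_ (RingHom.FiniteType.of_surjective _ ?_)
    · exact (HasRingHomProperty.iff_of_isAffine (P := @LocallyOfFiniteType)).1 inferInstance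
    · exact (ConcreteCategory.bijective_of_isIso (Scheme.ΓSpecIso (.of k)).inv).2
  algebraize [π.appTop.hom.comp (Scheme.ΓSpecIso (.of k)).inv.hom]
  exact ⟨finite_maximalSpectrum_of_isLocalization (nonvanishing X s) hT hM,
    fun m hm => finite_quotient_of_isLocalization k (nonvanishing X s) hT hM hm⟩

end SemilocalRing

/-! ### The equation of the fibre of the embedded scheme. -/

section Fibre

open Polynomial

/-- The evaluation `R[t] ⟶ D` at `d`. -/
def evalLine (R : Type u) {D : Type u} [CommRing R] [CommRing D] [Algebra R D] (d : D) :
    MvPolynomial PUnit.{u + 1} R →ₐ[R] D :=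
  MvPolynomial.aeval fun _ => d

theorem evalLine_surjective {R D : Type u} [CommRing R] [CommRing D] [Algebra R D] {d : D}
    (hd : Algebra.adjoin R {d} = ⊤) : Function.Surjective (evalLine R d) := by
  rw [← AlgHom.range_eq_top, evalLine, ← Algebra.adjoin_range_eq_range_aeval, Set.range_const, hd]

theorem evalLine_uniqueAlgEquiv_symm {R D : Type u} [CommRing R] [CommRing D] [Algebra R D] (d : D)
    (p : R[X]) :
    evalLine R d ((MvPolynomial.uniqueAlgEquiv R PUnit.{u + 1}).symm p) = aeval d p := by
  have : (evalLine R d).comp (MvPolynomial.uniqueAlgEquiv R PUnit.{u + 1}).symm.toAlgHom =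
      aeval d := by
    ext; simp [evalLine]
  exact congr($this p)

theorem natDegree_minpoly_of_adjoin_eq_top {κ E : Type*} [Field κ] [CommRing E] [Algebra κ E]
    [FiniteDimensional κ E] {c : E} (hc : Algebra.adjoin κ {c} = ⊤) :
    (minpoly κ c).natDegree = Module.finrank κ E := by
  rw [← Algebra.adjoin.powerBasis_dim (.of_finite κ c), ← PowerBasis.finrank, hc]
  exact Subalgebra.topEquiv.toLinearEquiv.finrank_eq

/-- The extended kernel is principal in `κ[t]`, and nonzero because `d` is integral over `O`. The
image of `d` generates each quotient `E` of `D`, so its minimal polynomial has degree `dim E` and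
divides the equation. -/
theorem exists_monic_map_ker_evalLine {O κ D E₁ E₂ : Type u} [CommRing O] [CommRing D] [Field κ]
    [CommRing E₁] [CommRing E₂] [Algebra O κ] [Algebra O D] [Algebra κ E₁] [Algebra κ E₂] [Algebra O E₁]
    [Algebra O E₂] [IsScalarTower O κ E₁] [IsScalarTower O κ E₂] [FiniteDimensional κ E₁]
    [FiniteDimensional κ E₂] [Module.Finite O D] {d : D} (hd : Algebra.adjoin O {d} = ⊤)
    (γ₁ : D →ₐ[O] E₁) (γ₂ : D →ₐ[O] E₂) (hγ₁ : Function.Surjective γ₁)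
    (hγ₂ : Function.Surjective γ₂) :
    ∃ f p₁ p₂ : κ[X], f.Monic ∧ p₁ ∣ f ∧ p₂ ∣ f ∧ p₁.natDegree = Module.finrank κ E₁ ∧
      p₂.natDegree = Module.finrank κ E₂ ∧
      (RingHom.ker (evalLine O d)).map (MvPolynomial.map (algebraMap O κ)) =
        Ideal.span {(MvPolynomial.uniqueAlgEquiv κ PUnit.{u + 1}).symm f} := by
  let e : MvPolynomial PUnit.{u + 1} O →+* MvPolynomial PUnit.{u + 1} κ :=
    MvPolynomial.map (algebraMap O κ)
  let ε := MvPolynomial.uniqueAlgEquiv κ PUnit.{u + 1}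
  let Ψ : MvPolynomial PUnit.{u + 1} O →+* κ[X] := ε.toRingEquiv.toRingHom.comp e
  let J := (RingHom.ker (evalLine O d)).map Ψ
  have hJ : J ≠ ⊥ := by
    obtain ⟨P, hP, hPd⟩ := Algebra.IsIntegral.isIntegral (R := O) d
    have hmem : (MvPolynomial.uniqueAlgEquiv O PUnit.{u + 1}).symm P ∈ RingHom.ker (evalLine O d) := by
      rw [RingHom.mem_ker, evalLine_uniqueAlgEquiv_symm]
      exact hPd
    have h := Ideal.mem_map_of_mem Ψ hmem
    have h' : Ψ ((MvPolynomial.uniqueAlgEquiv O PUnit.{u + 1}).symm P) =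
        P.map (algebraMap O κ) := by
      have h1 : Ψ.comp (MvPolynomial.uniqueAlgEquiv O PUnit.{u + 1}).symm.toRingEquiv.toRingHom =
          mapRingHom (algebraMap O κ) := by
        refine Polynomial.ringHom_ext (fun a => ?_) ?_
        · simp [Ψ, e, ε]
        · simp [Ψ, e, ε]
      exact congr($h1 P)
    rw [h'] at h
    intro hbot
    rw [show (RingHom.ker (evalLine O d)).map Ψ = ⊥ from hbot, Ideal.mem_bot] at h
    exact (hP.map _).ne_zero h
  obtain ⟨g, hg⟩ := (IsPrincipalIdealRing.principal J).principal
  replace hg : J = Ideal.span {g} := hg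
  have hg0 : g ≠ 0 := by
    rintro rfl
    exact hJ (by simpa using hg)
  let f := g * C g.leadingCoeff⁻¹
  have hf : J = Ideal.span {f} := by
    rw [hg, Ideal.span_singleton_eq_span_singleton]
    exact associated_mul_unit_right _ _ (isUnit_C.2
      (isUnit_iff_ne_zero.2 (inv_ne_zero (leadingCoeff_ne_zero.2 hg0))))
  have hdvd {E : Type u} [CommRing E] [Algebra κ E] [Algebra O E] [IsScalarTower O κ E]
      [FiniteDimensional κ E] (γ : D →ₐ[O] E) (hγ : Function.Surjective γ) :
      minpoly κ (γ d) ∣ f ∧ (minpoly κ (γ d)).natDegree = Module.finrank κ E := by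
    constructor
    · have hle : J ≤ RingHom.ker (aeval (R := κ) (γ d)) := by
        rw [Ideal.map_le_iff_le_comap]
        intro x hx
        rw [Ideal.mem_comap, RingHom.mem_ker]
        have h1 : (aeval (R := κ) (γ d)).toRingHom.comp Ψ =
            γ.toRingHom.comp (evalLine O d).toRingHom := by
          refine MvPolynomial.ringHom_ext (fun a => ?_) fun i => ?_
          · simp [Ψ, e, ε, evalLine, ← IsScalarTower.algebraMap_apply]
          · simp [Ψ, e, ε, evalLine]
        refine (congr($h1 x)).trans ?_
        change γ (evalLine O d x) = 0
        rw [RingHom.mem_ker.1 hx, map_zero]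
      exact minpoly.dvd _ _ (hle (hf ▸ Ideal.mem_span_singleton_self f))
    · refine natDegree_minpoly_of_adjoin_eq_top ?_
      have h2 := congr_arg (Subalgebra.map γ) hd
      rw [AlgHom.map_adjoin, Set.image_singleton, Algebra.map_top, (AlgHom.range_eq_top γ).2 hγ] at h2
      refine top_unique fun y _ => ?_
      have hy : y ∈ Algebra.adjoin O {γ d} := h2 ▸ Algebra.mem_top
      refine Algebra.adjoin_le (S := (Algebra.adjoin κ {γ d}).restrictScalars O) ?_ hy
      exact Algebra.subset_adjoin
  refine ⟨f, _, _, monic_mul_leadingCoeff_inv hg0, (hdvd γ₁ hγ₁).1, (hdvd γ₂ hγ₂).1,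
    (hdvd γ₁ hγ₁).2, (hdvd γ₂ hγ₂).2, ?_⟩
  have h3 := congr_arg (Ideal.map ε.symm.toRingEquiv.toRingHom) hf
  rw [Ideal.map_span, Set.image_singleton, Ideal.map_map] at h3
  refine Eq.trans ?_ h3
  congr 1
  exact RingHom.ext fun x => (ε.symm_apply_apply (e x)).symm

/-- The rational point `β` turns the two factors into surjections from `D` to `κ ⊗ k₁` and `κ ⊗ k₂`;
this is the source of the coprime degrees. -/
theorem exists_monic_map_ker_evalLine_tensor {k O κ B k₁ k₂ : Type u} [Field k] [CommRing O]
    [CommRing B] [Field κ] [Field k₁] [Field k₂] [Algebra k O] [Algebra O κ] [Algebra k κ]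
    [IsScalarTower k O κ] [Algebra O B] [Algebra k B] [IsScalarTower k O B] [Module.Finite O B]
    [Algebra k k₁] [Algebra k k₂] [FiniteDimensional k k₁] [FiniteDimensional k k₂]
    {d : (B ⊗[k] k₁) × (B ⊗[k] k₂)} (hd : Algebra.adjoin O {d} = ⊤)
    (hκ : Function.Surjective (algebraMap O κ)) (β : B →ₐ[O] κ) :
    ∃ f p₁ p₂ : κ[X], f.Monic ∧ p₁ ∣ f ∧ p₂ ∣ f ∧ p₁.natDegree = Module.finrank k k₁ ∧
      p₂.natDegree = Module.finrank k k₂ ∧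
      (RingHom.ker (evalLine O d)).map (MvPolynomial.map (algebraMap O κ)) =
        Ideal.span {(MvPolynomial.uniqueAlgEquiv κ PUnit.{u + 1}).symm f} := by
  have : Module.Finite O (B ⊗[k] k₁) := .trans B _
  have : Module.Finite O (B ⊗[k] k₂) := .trans B _
  have hβ : Function.Surjective β := fun y => by
    obtain ⟨x, rfl⟩ := hκ y
    exact ⟨algebraMap O B x, β.commutes x⟩
  have hsurj (l : Type u) [Field l] [Algebra k l] :
      Function.Surjective (Algebra.TensorProduct.map β (AlgHom.id k l)) :=
    TensorProduct.map_surjective (g := β.toLinearMap.restrictScalars k)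
      (g' := (LinearMap.id : l →ₗ[k] l)) hβ Function.surjective_id
  obtain ⟨f, p₁, p₂, hf, h₁, h₂, hd₁, hd₂, h⟩ := exists_monic_map_ker_evalLine (κ := κ) hd
    ((Algebra.TensorProduct.map β (AlgHom.id k k₁)).comp (AlgHom.fst O _ _))
    ((Algebra.TensorProduct.map β (AlgHom.id k k₂)).comp (AlgHom.snd O _ _))
    ((hsurj k₁).comp Prod.fst_surjective) ((hsurj k₂).comp Prod.snd_surjective)
  exact ⟨f, p₁, p₂, hf, h₁, h₂, hd₁.trans (Module.finrank_baseChange ..),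
    hd₂.trans (Module.finrank_baseChange ..), h⟩

theorem isField_tensorProduct_of_surjective {k O κ l : Type*} [Field k] [CommRing O] [Field κ]
    [Field l] [Algebra k O] [Algebra O κ] [Algebra k κ] [IsScalarTower k O κ] [Algebra k l]
    (hκ : Function.Surjective (algebraMap O κ))
    (h : ∀ m : Ideal O, m.IsMaximal → IsField ((O ⧸ m) ⊗[k] l)) : IsField (κ ⊗[k] l) := by
  let e := Ideal.quotientKerAlgEquivOfSurjective (f := IsScalarTower.toAlgHom k O κ) hκ
  exact (Algebra.TensorProduct.congr e (AlgEquiv.refl (R := k) (A₁ := l))).symm.toMulEquiv.isField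
    (h _ (RingHom.ker_isMaximal_of_surjective (algebraMap O κ) hκ))

theorem exists_span_residue {O R κ L : Type*} [CommRing O] [CommRing R] [Field κ] [Field L]
    [Algebra O R] {s : Finset R} (hs : Submodule.span O (s : Set R) = ⊤) [Algebra κ L]
    {ρ : O →+* κ} {ψ : R →+* L} (hψ : Function.Surjective ψ)
    (h : (algebraMap κ L).comp ρ = ψ.comp (algebraMap O R)) :
    Module.Finite κ L ∧ Module.finrank κ L ≤ s.card := by
  classical
  have hspan : Submodule.span κ ((s.image ψ : Finset L) : Set L) = ⊤ := by
    refine top_unique fun y _ => ?_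
    obtain ⟨x, rfl⟩ := hψ y
    have hx : x ∈ Submodule.span O (s : Set R) := hs ▸ Submodule.mem_top
    induction hx using Submodule.span_induction with
    | mem x hx => exact Submodule.subset_span (by simpa using ⟨x, hx, rfl⟩)
    | zero => simp
    | add x y _ _ hx hy => rw [map_add]; exact add_mem (hx trivial) (hy trivial)
    | smul a x _ hx =>
      rw [Algebra.smul_def, map_mul, ← RingHom.comp_apply ψ, ← h, RingHom.comp_apply,
        ← Algebra.smul_def]
      exact Submodule.smul_mem _ _ (hx trivial)
  refine ⟨⟨⟨_, hspan⟩⟩, ?_⟩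
  have h1 := finrank_span_finset_le_card (R := κ) (s.image ψ)
  rw [Set.finrank, hspan, finrank_top] at h1
  exact h1.trans Finset.card_image_le

end Fibre

/-! ### From algebra to schemes. -/

section Glue

theorem exists_iso_extendScalars {k B : Type u} [Field k] [CommRing B] [Algebra k B]
    {Y : Scheme.{u}} {q : Y ⟶ Spec (CommRingCat.of k)} (ε : Y ≅ Spec (CommRingCat.of B))
    (hε : q = ε.hom ≫ Spec.map (CommRingCat.ofHom (algebraMap k B))) (l : Type u) [Field l]
    [Algebra k l] :
    ∃ θ : extendScalars q l ≅ Spec (CommRingCat.of (B ⊗[k] l)),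
      θ.hom ≫ Spec.map (CommRingCat.ofHom (algebraMap B (B ⊗[k] l))) =
        pullback.fst _ _ ≫ ε.hom := by
  let a : extendScalars q l ⟶ pullback (Spec.map (CommRingCat.ofHom (algebraMap k B)))
      (Spec.map (CommRingCat.ofHom (algebraMap k l))) :=
    pullback.map _ _ _ _ ε.hom (𝟙 _) (𝟙 _) (by simp [hε]) (by simp [specExt])
  refine ⟨asIso a ≪≫ pullbackSpecIso k B l, ?_⟩
  simp only [Iso.trans_hom, asIso_hom, Category.assoc, pullbackSpecIso_hom_fst']
  exact pullback.lift_fst _ _ _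

theorem exists_iso_coprod {O R₁ R₂ : Type u} [CommRing O] [CommRing R₁] [CommRing R₂]
    [Algebra O R₁] [Algebra O R₂] {Y₁ Y₂ : Scheme.{u}} (θ₁ : Y₁ ≅ Spec (CommRingCat.of R₁))
    (θ₂ : Y₂ ≅ Spec (CommRingCat.of R₂)) :
    ∃ Θ : Y₁ ⨿ Y₂ ≅ Spec (CommRingCat.of (R₁ × R₂)),
      Θ.hom ≫ Spec.map (CommRingCat.ofHom (algebraMap O (R₁ × R₂))) =
        coprod.desc (θ₁.hom ≫ Spec.map (CommRingCat.ofHom (algebraMap O R₁)))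
          (θ₂.hom ≫ Spec.map (CommRingCat.ofHom (algebraMap O R₂))) := by
  refine ⟨coprod.mapIso θ₁ θ₂ ≪≫ asIso (coprodSpec R₁ R₂), ?_⟩
  refine coprod.hom_ext ?_ ?_
  · rw [coprod.inl_desc, Iso.trans_hom, coprod.mapIso_hom, asIso_hom, Category.assoc,
      coprod.inl_map_assoc, coprodSpec_inl_assoc, ← Spec.map_comp, ← CommRingCat.ofHom_comp]
    rfl
  · rw [coprod.inr_desc, Iso.trans_hom, coprod.mapIso_hom, asIso_hom, Category.assoc,
      coprod.inr_map_assoc, coprodSpec_inr_assoc, ← Spec.map_comp, ← CommRingCat.ofHom_comp]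
    rfl

variable {O D : Type u} [CommRing O] [CommRing D] [Algebra O D]

/-- The morphism `Spec D ⟶ 𝔸¹_O` given by an element `d` of the `O`-algebra `D`. -/
def toAffineLine (O : Type u) {D : Type u} [CommRing O] [CommRing D] [Algebra O D] (d : D) :
    Spec (CommRingCat.of D) ⟶ AffineLine (Spec (CommRingCat.of O)) :=
  Spec.map (CommRingCat.ofHom (evalLine O d).toRingHom) ≫ 
    (AffineSpace.SpecIso PUnit.{u + 1} (CommRingCat.of O)).inv

theorem toAffineLine_proj (d : D) :
    toAffineLine O d ≫ AffineLine.proj _ = Spec.map (CommRingCat.ofHom (algebraMap O D)) := by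
  rw [toAffineLine, Category.assoc, AffineSpace.SpecIso_inv_over, ← Spec.map_comp,
    ← CommRingCat.ofHom_comp]
  congr 2
  exact (evalLine O d).comp_algebraMap

theorem isClosedImmersion_toAffineLine {d : D} (hd : Algebra.adjoin O {d} = ⊤) :
    IsClosedImmersion (toAffineLine O d) := by
  have : IsClosedImmersion (Spec.map (CommRingCat.ofHom (evalLine O d).toRingHom)) :=
    .spec_of_surjective _ (evalLine_surjective hd)
  rw [toAffineLine]
  infer_instance

theorem mem_range_toAffineLine {d : D} (hd : Algebra.adjoin O {d} = ⊤)
    (a : AffineLine (Spec (CommRingCat.of O))) :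
    a ∈ Set.range (toAffineLine O d) ↔ RingHom.ker (evalLine O d) ≤
      ((AffineSpace.SpecIso PUnit.{u + 1} (CommRingCat.of O)).hom a).asIdeal := by
  let e := AffineSpace.SpecIso PUnit.{u + 1} (CommRingCat.of O)
  have h1 := range_comap_of_surjective _ (evalLine O d).toRingHom
    (evalLine_surjective hd)
  have h2 : e.hom a ∈ Set.range (PrimeSpectrum.comap (evalLine O d).toRingHom) ↔
      RingHom.ker (evalLine O d) ≤ (e.hom a).asIdeal := by
    rw [h1]; exact PrimeSpectrum.mem_zeroLocus _ _
  refine Iff.trans ?_ h2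
  constructor
  · rintro ⟨y, rfl⟩
    refine ⟨y, ?_⟩
    rw [← Scheme.Hom.comp_apply, toAffineLine, Category.assoc, Iso.inv_hom_id, Category.comp_id]
    rfl
  · rintro ⟨y, hy⟩
    let y' : Spec (CommRingCat.of D) := y
    have : Spec.map (CommRingCat.ofHom (evalLine O d).toRingHom) y' = e.hom a := hy
    refine ⟨y', ?_⟩
    rw [toAffineLine, Scheme.Hom.comp_apply, this, ← Scheme.Hom.comp_apply, Iso.hom_inv_id]
    rfl

/-- The homomorphism `R ⟶ k(u)` at a point `u` of `Spec R`. -/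
def evalResidue (O : Type u) [CommRing O] (u : Spec (CommRingCat.of O)) :
    O →+* (Spec (CommRingCat.of O)).residueField u :=
  (Spec.preimage ((Spec (CommRingCat.of O)).fromSpecResidueField u)).hom

theorem specMap_evalResidue (u : Spec (CommRingCat.of O)) :
    Spec.map (CommRingCat.ofHom (evalResidue O u)) =
      (Spec (CommRingCat.of O)).fromSpecResidueField u :=
  Spec.map_preimage _

theorem surjective_of_isClosedImmersion {R S : CommRingCat.{u}} (f : R ⟶ S)
    [IsClosedImmersion (Spec.map f)] : Function.Surjective f := by
  have h := (IsClosedImmersion.isAffine_surjective_of_isAffine (Spec.map f)).2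
  have h2 := Scheme.ΓSpecIso_inv_naturality f
  have h3 : f = (Scheme.ΓSpecIso R).inv ≫ (Spec.map f).appTop ≫ (Scheme.ΓSpecIso S).hom := by
    rw [← Category.assoc, ← h2, Category.assoc, Iso.inv_hom_id, Category.comp_id]
  rw [h3]
  refine ((ConcreteCategory.bijective_of_isIso (Scheme.ΓSpecIso S).hom).2.comp h).comp
    (ConcreteCategory.bijective_of_isIso (Scheme.ΓSpecIso R).inv).2

theorem evalResidue_surjective {u : Spec (CommRingCat.of O)}
    (hu : IsClosed ({u} : Set (Spec (CommRingCat.of O)))) :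
    Function.Surjective (evalResidue O u) := by
  have : IsClosedImmersion (Spec.map (CommRingCat.ofHom (evalResidue O u))) := by
    rw [specMap_evalResidue]
    exact isClosed_singleton_iff_isClosedImmersion.1 hu
  exact surjective_of_isClosedImmersion (CommRingCat.ofHom (evalResidue O u))

theorem toResidueField_eq {k : Type u} [Field k] [Algebra k O] (u : Spec (CommRingCat.of O)) :
    toResidueField (Spec.map (CommRingCat.ofHom (algebraMap k O))) u =
      (evalResidue O u).comp (algebraMap k O) := by
  rw [toResidueField, ← specMap_evalResidue, ← Spec.map_comp, Spec.preimage_map]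
  rfl

/-- The size of a generating set of the functions on `Z` over `O` bounds all these degrees at once.
-/
theorem exists_residueDegree_le {Z : Scheme.{u}} (q : Z ⟶ Spec (CommRingCat.of O)) [IsFinite q] :
    ∃ N : ℕ, ∀ z : Z, IsClosed ({z} : Set Z) →
      (q.residueFieldMap z).hom.Finite ∧ q.residueDegree z ≤ N := by
  have : IsAffine Z := isAffine_of_isAffineHom q
  let χ : CommRingCat.of O ⟶ Γ(Z, ⊤) := Spec.preimage (Z.isoSpec.inv ≫ q)
  have hχ : Spec.map χ = Z.isoSpec.inv ≫ q := Spec.map_preimage _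
  have hfin : χ.hom.Finite := by
    rw [← IsFinite.SpecMap_iff, hχ]
    infer_instance
  algebraize [χ.hom]
  obtain ⟨s, hs⟩ := Module.Finite.fg_top (R := O) (M := Γ(Z, ⊤))
  refine ⟨s.card, fun z hz => ?_⟩
  let ψ : Γ(Z, ⊤) ⟶ Z.residueField z := Spec.preimage (Z.fromSpecResidueField z ≫ Z.isoSpec.hom)
  have hψ : Spec.map ψ = Z.fromSpecResidueField z ≫ Z.isoSpec.hom := Spec.map_preimage _
  have := isClosed_singleton_iff_isClosedImmersion.1 hz
  have : IsClosedImmersion (Spec.map ψ) := by rw [hψ]; infer_instance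
  have hsurj := surjective_of_isClosedImmersion ψ
  have hcomm : CommRingCat.ofHom (evalResidue O (q z)) ≫ q.residueFieldMap z = χ ≫ ψ := by
    apply Spec.map_injective
    rw [Spec.map_comp, Spec.map_comp, specMap_evalResidue, hχ, hψ,
      Scheme.Hom.SpecMap_residueFieldMap_fromSpecResidueField]
    simp
  let _ := (q.residueFieldMap z).hom.toAlgebra
  exact exists_span_residue hs hsurj congr(($hcomm).hom)

/-- A point of a scheme over `𝔸¹_O` whose image lies on the image of `Spec D` gives a homomorphism
from `D` to its residue field. -/
theorem exists_ringHom_residueField {Z : Scheme.{u}}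
    (iZ : Z ⟶ AffineLine (Spec (CommRingCat.of O))) {d : D} (hd : Algebra.adjoin O {d} = ⊤) {z : Z}
    (hz : iZ z ∈ Set.range (toAffineLine O d)) :
    ∃ δ : D →+* Z.residueField z, δ.comp (algebraMap O D) =
      ((iZ ≫ AffineLine.proj _).residueFieldMap z).hom.comp (evalResidue O _) := by
  let e := AffineSpace.SpecIso PUnit.{u + 1} (CommRingCat.of O)
  let μ : CommRingCat.of (MvPolynomial PUnit.{u + 1} O) ⟶ Z.residueField z :=
    Spec.preimage (Z.fromSpecResidueField z ≫ iZ ≫ e.hom)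
  have hμ : Spec.map μ = Z.fromSpecResidueField z ≫ iZ ≫ e.hom := Spec.map_preimage _
  have hker : RingHom.ker (evalLine O d).toRingHom ≤ RingHom.ker μ.hom := by
    have h1 := (mem_range_toAffineLine hd _).1 hz
    have h2 : e.hom (iZ z) = Spec.map μ default := by
      rw [hμ, Scheme.Hom.comp_apply, Scheme.Hom.comp_apply, Scheme.fromSpecResidueField_apply]
    have h3 : (e.hom (iZ z)).asIdeal = RingHom.ker μ.hom := by
      rw [h2]
      change Ideal.comap μ.hom (default : Spec (Z.residueField z)).asIdeal = _
      have := (default : Spec (Z.residueField z)).isPrime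
      rw [Ideal.eq_bot_of_prime (default : Spec (Z.residueField z)).asIdeal]
      rfl
    exact h3 ▸ h1
  refine ⟨(evalLine O d).toRingHom.liftOfSurjective (evalLine_surjective hd) ⟨μ.hom, hker⟩, ?_⟩
  have h4 : CommRingCat.ofHom MvPolynomial.C ≫ μ = CommRingCat.ofHom (evalResidue O _) ≫
      (iZ ≫ AffineLine.proj _).residueFieldMap z := by
    apply Spec.map_injective
    rw [Spec.map_comp, Spec.map_comp, specMap_evalResidue, hμ,
      Scheme.Hom.SpecMap_residueFieldMap_fromSpecResidueField, Category.assoc, Category.assoc]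
    congr 2
    exact ((Iso.inv_comp_eq e).1 (AffineSpace.SpecIso_inv_over _)).symm
  refine RingHom.ext fun x => ?_
  refine Eq.trans ?_ congr(($h4).hom x)
  rw [RingHom.comp_apply, ← (evalLine O d).commutes]
  exact RingHom.liftOfRightInverse_comp_apply _ _ _ _ _

theorem exists_algHom_of_hasRationalPointOver {B : Type u} [CommRing B] [Algebra O B]
    {Y : Scheme.{u}} {p : Y ⟶ Spec (CommRingCat.of O)} (ε : Y ≅ Spec (CommRingCat.of B))
    (hε : p = ε.hom ≫ Spec.map (CommRingCat.ofHom (algebraMap O B)))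
    {u : Spec (CommRingCat.of O)} (h : HasRationalPointOver p u) :
    ∃ β : B →+* (Spec (CommRingCat.of O)).residueField u,
      β.comp (algebraMap O B) = evalResidue O u := by
  obtain ⟨σ, hσ⟩ := h
  refine ⟨(Spec.preimage (σ ≫ p.fiberι u ≫ ε.hom)).hom, ?_⟩
  suffices h : CommRingCat.ofHom (algebraMap O B) ≫ Spec.preimage (σ ≫ p.fiberι u ≫ ε.hom) =
      CommRingCat.ofHom (evalResidue O u) from congr(($h).hom)
  apply Spec.map_injective
  rw [Spec.map_comp, Spec.map_preimage, specMap_evalResidue, Category.assoc, Category.assoc, ← hε,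
    Scheme.Hom.fiber_fac, reassoc_of% hσ]

theorem exists_opens_pic_eq_zero {d : D} (hd : Algebra.adjoin O {d} = ⊤)
    {u : Spec (CommRingCat.of O)} {T : Set (AffineLine (Spec (CommRingCat.of O)))}
    (hT : T = Set.range (toAffineLine O d))
    {f p₁ p₂ : Polynomial ((Spec (CommRingCat.of O)).residueField u)} (hf : f.Monic)
    (h₁ : p₁ ∣ f) (h₂ : p₂ ∣ f) (hn : p₁.natDegree.Coprime p₂.natDegree) (h : 1 < p₂.natDegree)
    (hker : (RingHom.ker (evalLine O d)).map (MvPolynomial.map (evalResidue O u)) =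
      Ideal.span {(MvPolynomial.uniqueAlgEquiv _ PUnit.{u + 1}).symm f}) :
    ∃ V : (ProjectiveLine ((Spec (CommRingCat.of O)).residueField u)).Opens,
      (V : Set (ProjectiveLine ((Spec (CommRingCat.of O)).residueField u))) =
        (affineToProjectiveLine _ '' (AffineLine.fromFibre _ u ⁻¹' T))ᶜ ∧
      ∀ c : Pic V.toScheme, c = 0 := by
  refine ⟨_, compl_image_affineToProjectiveLine hf ?_ fun a => ?_,
    pic_basicOpen_homogenization hf.ne_zero h₁ h₂ hn h⟩
  -- The equation is not `1`, having a divisor of degree greater than one.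
  · rintro rfl
    have := Polynomial.natDegree_le_of_dvd h₂ one_ne_zero
    rw [Polynomial.natDegree_one] at this
    omega
  · have h1 : AffineLine.fromFibre _ u = (AffineSpace.SpecIso PUnit.{u + 1} _).hom ≫
        Spec.map (CommRingCat.ofHom (MvPolynomial.map (evalResidue O u))) ≫
          (AffineSpace.SpecIso PUnit.{u + 1} (CommRingCat.of O)).inv := by
      rw [AffineLine.fromFibre, ← specMap_evalResidue]
      exact AffineSpace.map_SpecMap _
    rw [Set.mem_preimage, hT, mem_range_toAffineLine hd, ← Scheme.Hom.comp_apply, h1,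
      Category.assoc, Category.assoc, Iso.inv_hom_id, Category.comp_id, Scheme.Hom.comp_apply]
    refine (Ideal.map_le_iff_le_comap (f := MvPolynomial.map (evalResidue O u))).symm.trans ?_
    rw [hker, Ideal.span_singleton_le_iff_mem]

/-- Of the semi-local ring only two properties matter: finitely many maximal ideals and finite
residue fields. -/
theorem exists_closed_embedding_of_finite_etale {k : Type u} [Field k] [Finite k]
    [Finite (MaximalSpectrum O)] (hO : ∀ m : Ideal O, m.IsMaximal → Finite (O ⧸ m))
    (g : Spec (CommRingCat.of O) ⟶ Spec (CommRingCat.of k))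
    {Z : Scheme.{u}} (iZ : Z ⟶ AffineLine (Spec (CommRingCat.of O))) [IsClosedImmersion iZ]
    [IsFinite (iZ ≫ AffineLine.proj (Spec (CommRingCat.of O)))]
    {Y' : Scheme.{u}} (p : Y' ⟶ Spec (CommRingCat.of O)) [IsFinite p] [Etale p]
    (hp : ∀ u : Spec (CommRingCat.of O), IsClosed ({u} : Set (Spec (CommRingCat.of O))) →
      HasRationalPointOver p u) :
    ∃ (k₁ k₂ : Type u) (_ : Field k₁) (_ : Field k₂) (_ : Algebra k k₁) (_ : Algebra k k₂)
      (_ : FiniteDimensional k k₁) (_ : FiniteDimensional k k₂),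
      Nat.Coprime (Module.finrank k k₁) (Module.finrank k k₂) ∧
      (∀ u : Spec (CommRingCat.of O), IsClosed ({u} : Set (Spec (CommRingCat.of O))) →
        IsFieldResidueTensor g u k₁ ∧ IsFieldResidueTensor g u k₂) ∧
      (∀ z : Z, IsClosed ({z} : Set Z) →
        (iZ ≫ AffineLine.proj (Spec (CommRingCat.of O))).residueDegree z < Module.finrank k k₁ ∧
        (iZ ≫ AffineLine.proj (Spec (CommRingCat.of O))).residueDegree z < Module.finrank k k₂) ∧
      ∃ i : extendScalars (p ≫ g) k₁ ⨿ extendScalars (p ≫ g) k₂ ⟶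
          AffineLine (Spec (CommRingCat.of O)),
        IsClosedImmersion i ∧
        i ≫ AffineLine.proj (Spec (CommRingCat.of O)) =
          coprod.desc (pullback.fst _ _ ≫ p) (pullback.fst _ _ ≫ p) ∧
        Set.range i ∩ Set.range iZ = ∅ ∧
        ∀ u : Spec (CommRingCat.of O), IsClosed ({u} : Set (Spec (CommRingCat.of O))) →
          ∃ V : (ProjectiveLine ((Spec (CommRingCat.of O)).residueField u)).Opens,
            (V : Set (ProjectiveLine ((Spec (CommRingCat.of O)).residueField u))) =
              (fibreInProjectiveLine i u)ᶜ ∧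
            ∀ c : Pic V.toScheme, c = 0 := by
  have : IsAffine Y' := isAffine_of_isAffineHom p
  let B := Γ(Y', ⊤)
  let ε : Y' ≅ Spec (CommRingCat.of B) := Y'.isoSpec
  let φ : CommRingCat.of k ⟶ CommRingCat.of O := Spec.preimage g
  have hφ : Spec.map φ = g := Spec.map_preimage g
  let χ : CommRingCat.of O ⟶ CommRingCat.of B := Spec.preimage (ε.inv ≫ p)
  have hχ : Spec.map χ = ε.inv ≫ p := Spec.map_preimage _
  have hχfin : χ.hom.Finite := by
    rw [← IsFinite.SpecMap_iff, hχ]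
    infer_instance
  have hχet : χ.hom.Etale := by
    rw [← HasRingHomProperty.Spec_iff (P := @Etale), hχ]
    infer_instance
  let _ : Algebra k O := φ.hom.toAlgebra
  let _ : Algebra O B := χ.hom.toAlgebra
  let _ : Algebra k B := (χ.hom.comp φ.hom).toAlgebra
  have : IsScalarTower k O B := .of_algebraMap_eq' rfl
  have : Module.Finite O B := hχfin
  have : Algebra.Etale O B := hχet
  have hpε : p = ε.hom ≫ Spec.map (CommRingCat.ofHom (algebraMap O B)) :=
    ((Iso.inv_comp_eq ε).1 hχ.symm)
  have hgφ : g = Spec.map (CommRingCat.ofHom (algebraMap k O)) := hφ.symm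
  have hpg : p ≫ g = ε.hom ≫ Spec.map (CommRingCat.ofHom (algebraMap k B)) := by
    rw [hpε, hgφ, Category.assoc, ← Spec.map_comp, ← CommRingCat.ofHom_comp]
  have hρ (u : Spec (CommRingCat.of O)) :
      toResidueField g u = (evalResidue O u).comp (algebraMap k O) := by
    rw [hgφ]
    exact toResidueField_eq u
  obtain ⟨N, hN⟩ := exists_residueDegree_le (iZ ≫ AffineLine.proj (Spec (CommRingCat.of O)))
  obtain ⟨k₁, k₂, _, _, _, _, _, _, hcop, h1, hN₁, hN₂, hfield, d, hd⟩ :=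
    exists_field_extensions k (O := O) (B := B) hO N
  have hres (u : Spec (CommRingCat.of O)) (hu : IsClosed ({u} : Set (Spec (CommRingCat.of O)))) :
      IsFieldResidueTensor g u k₁ ∧ IsFieldResidueTensor g u k₂ := by
    let _ : Algebra O ((Spec (CommRingCat.of O)).residueField u) := (evalResidue O u).toAlgebra
    let _ : Algebra k ((Spec (CommRingCat.of O)).residueField u) := (toResidueField g u).toAlgebra
    have : IsScalarTower k O ((Spec (CommRingCat.of O)).residueField u) :=
      .of_algebraMap_eq' (hρ u)
    exact ⟨isField_tensorProduct_of_surjective (evalResidue_surjective hu) fun m hm =>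
      (hfield m hm).1, isField_tensorProduct_of_surjective (evalResidue_surjective hu) fun m hm =>
      (hfield m hm).2⟩
  obtain ⟨θ₁, hθ₁⟩ := exists_iso_extendScalars ε hpg k₁
  obtain ⟨θ₂, hθ₂⟩ := exists_iso_extendScalars ε hpg k₂
  obtain ⟨Θ, hΘ⟩ := exists_iso_coprod (O := O) θ₁ θ₂
  have hrange : Set.range (Θ.hom ≫ toAffineLine O d) = Set.range (toAffineLine O d) := by
    rw [Scheme.Hom.comp_base, TopCat.coe_comp]
    exact (Scheme.Hom.surjective _).range_comp _
  have := isClosedImmersion_toAffineLine hd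
  refine ⟨k₁, k₂, _, _, _, _, inferInstance, inferInstance, hcop, hres, fun z hz =>
    ⟨(hN z hz).2.trans_lt hN₁, (hN z hz).2.trans_lt hN₂⟩, Θ.hom ≫ toAffineLine O d, inferInstance,
    ?_, ?_, fun u hu => ?_⟩
  · rw [Category.assoc, toAffineLine_proj, hΘ]
    have htower (l : Type u) [Field l] [Algebra k l] :
        Spec.map (CommRingCat.ofHom (algebraMap O (B ⊗[k] l))) =
          Spec.map (CommRingCat.ofHom (algebraMap B (B ⊗[k] l))) ≫
            Spec.map (CommRingCat.ofHom (algebraMap O B)) := by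
      rw [← Spec.map_comp, ← CommRingCat.ofHom_comp]
    rw [htower k₁, htower k₂, reassoc_of% hθ₁, reassoc_of% hθ₂, ← hpε]
  · rw [hrange, Set.eq_empty_iff_forall_notMem]
    rintro _ ⟨ha, z₀, rfl⟩
    have : IsAffine Z := isAffine_of_isAffineHom (iZ ≫ AffineLine.proj (Spec (CommRingCat.of O)))
    -- The intersection is closed in the affine scheme `Z`, so if nonempty it contains a closed
    -- point, where the degree bound applies.
    obtain ⟨z, hz, hcl⟩ := ((toAffineLine O d).isClosedEmbedding.isClosed_range.preimage
      iZ.continuous).exists_closed_singleton ⟨z₀, ha⟩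
    obtain ⟨δ, hδ⟩ := exists_ringHom_residueField iZ hd hz
    have hu : IsClosed ({(iZ ≫ AffineLine.proj (Spec (CommRingCat.of O))) z} :
        Set (Spec (CommRingCat.of O))) := by
      have := (iZ ≫ AffineLine.proj (Spec (CommRingCat.of O))).isClosedMap _ hcl
      rwa [Set.image_singleton] at this
    set u := (iZ ≫ AffineLine.proj (Spec (CommRingCat.of O))) z with hu'
    let τ := ((iZ ≫ AffineLine.proj (Spec (CommRingCat.of O))).residueFieldMap z).hom
    let _ : Algebra k ((Spec (CommRingCat.of O)).residueField u) := (toResidueField g u).toAlgebra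
    let _ : Algebra ((Spec (CommRingCat.of O)).residueField u) (Z.residueField z) := τ.toAlgebra
    let _ : Algebra k (Z.residueField z) := (τ.comp (toResidueField g u)).toAlgebra
    have : IsScalarTower k ((Spec (CommRingCat.of O)).residueField u) (Z.residueField z) :=
      .of_algebraMap_eq' rfl
    have : Module.Finite ((Spec (CommRingCat.of O)).residueField u) (Z.residueField z) :=
      (hN z hcl).1
    have hdeg : Module.finrank ((Spec (CommRingCat.of O)).residueField u) (Z.residueField z) ≤ N :=
      (hN z hcl).2
    let Δ : (B ⊗[k] k₁) × (B ⊗[k] k₂) →ₐ[k] Z.residueField z :=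
      { δ with
        commutes' := fun c => by
          have h2 := congr($hδ (algebraMap k O c))
          refine h2.trans ?_
          change _ = τ (toResidueField g u c)
          rw [hρ]
          rfl }
    -- Either case maps some `k_r` into `k(z)`, so `[k(z) : k(u)]` would be at least `[k_r : k]`,
    -- which exceeds `N`.
    obtain ⟨⟨ψ⟩⟩ | ⟨⟨ψ⟩⟩ := nonempty_algHom_of_prod Δ
    · have := finrank_le_of_algHom (hres u hu).1 (ψ.comp Algebra.TensorProduct.includeRight)
      omega
    · have := finrank_le_of_algHom (hres u hu).2 (ψ.comp Algebra.TensorProduct.includeRight)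
      omega
  · let _ : Algebra O ((Spec (CommRingCat.of O)).residueField u) := (evalResidue O u).toAlgebra
    let _ : Algebra k ((Spec (CommRingCat.of O)).residueField u) := (toResidueField g u).toAlgebra
    have : IsScalarTower k O ((Spec (CommRingCat.of O)).residueField u) :=
      .of_algebraMap_eq' (hρ u)
    obtain ⟨β, hβ⟩ := exists_algHom_of_hasRationalPointOver ε hpε (hp u hu)
    obtain ⟨f, p₁, p₂, hf, h₁, h₂, hd₁, hd₂, hker⟩ := exists_monic_map_ker_evalLine_tensor
      (κ := (Spec (CommRingCat.of O)).residueField u) hd (evalResidue_surjective hu)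
      { β with commutes' := fun x => congr($hβ x) }
    exact exists_opens_pic_eq_zero hd hrange hf h₁ h₂ (by rwa [hd₁, hd₂]) (by rwa [hd₂]) hker

end Glue

end SemilocalLine

end

theorem lemma3p1 {k : Type u} [Field k] [Finite k]
    {X : Scheme.{u}} [IsAffine X] [IrreducibleSpace X]
    (π : X ⟶ Spec (CommRingCat.of k)) [Smooth π]
    (s : Finset X) (hs : s.Nonempty) (hcl : ∀ x ∈ s, IsClosed ({x} : Set X))
    {Z : Scheme.{u}} (iZ : Z ⟶ AffineLine (semilocalSpec X s)) [IsClosedImmersion iZ]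
    [IsFinite (iZ ≫ AffineLine.proj (semilocalSpec X s))]
    {Y' : Scheme.{u}} (p : Y' ⟶ semilocalSpec X s) [IsFinite p] [Etale p]
    (hp : ∀ u : semilocalSpec X s, IsClosed ({u} : Set (semilocalSpec X s)) →
      HasRationalPointOver p u) :
    ∃ (k₁ k₂ : Type u) (_ : Field k₁) (_ : Field k₂) (_ : Algebra k k₁) (_ : Algebra k k₂)
      (_ : FiniteDimensional k k₁) (_ : FiniteDimensional k k₂),
      Nat.Coprime (Module.finrank k k₁) (Module.finrank k k₂) ∧
      (∀ u : semilocalSpec X s, IsClosed ({u} : Set (semilocalSpec X s)) →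
        IsFieldResidueTensor (semilocalSpecι X s ≫ π) u k₁ ∧
        IsFieldResidueTensor (semilocalSpecι X s ≫ π) u k₂) ∧
      (∀ z : Z, IsClosed ({z} : Set Z) →
        (iZ ≫ AffineLine.proj (semilocalSpec X s)).residueDegree z < Module.finrank k k₁ ∧
        (iZ ≫ AffineLine.proj (semilocalSpec X s)).residueDegree z < Module.finrank k k₂) ∧
      ∃ i : extendScalars (p ≫ semilocalSpecι X s ≫ π) k₁ ⨿
          extendScalars (p ≫ semilocalSpecι X s ≫ π) k₂ ⟶ AffineLine (semilocalSpec X s),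
        IsClosedImmersion i ∧
        i ≫ AffineLine.proj (semilocalSpec X s) =
          coprod.desc (pullback.fst _ _ ≫ p) (pullback.fst _ _ ≫ p) ∧
        Set.range i ∩ Set.range iZ = ∅ ∧
        ∀ u : semilocalSpec X s, IsClosed ({u} : Set (semilocalSpec X s)) →
          ∃ V : (ProjectiveLine ((semilocalSpec X s).residueField u)).Opens,
            (V : Set (ProjectiveLine ((semilocalSpec X s).residueField u))) =
              (fibreInProjectiveLine i u)ᶜ ∧
            ∀ c : Pic V.toScheme, c = 0 := by
  obtain ⟨hfin, hres⟩ := finite_semilocal π s hcl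
  exact @exists_closed_embedding_of_finite_etale (Localization (nonvanishing X s)) _ k _ _ hfin hres
    (semilocalSpecι X s ≫ π) Z iZ ‹IsClosedImmersion iZ›
    ‹IsFinite (iZ ≫ AffineLine.proj (semilocalSpec X s))› Y' p ‹IsFinite p› ‹Etale p› hp
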